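/- Let $B$ be a $d$-dimensional Brownian motion on a probability space, and let $r=(r(t))_{t\ge 0}$ be a right-continuous Markov chain on $\mathbb S=\{1,\dots,m\}$, independent of $B$, with $r(0)=\ell$ and generator $\Gamma=(\gamma_{ij})$, i.e. $\gamma_{ij}\ge 0$ for $i\ne j$, $\sum_j\gamma_{ij}=0$, and $P(r(t+\delta)=j\mid r(t)=i)=\mathbf 1_{\{i=j\}}+\gamma_{ij}\delta+o(\delta)$ as $\delta\downarrow 0$. Assume that the chain is irreducible in the sense that $\pi\Gamma=0$, $\sum_i\pi_i=1$ has a unique solution $\pi$, and $\pi_i>0$ for all $i$. For $u\in\mathbb R^m$ and $p>0$ let $\eta_{p,u}=-\max\{\mathrm{Re}\,\nu:\nu\in\mathrm{spec}(\Gamma+\tfrac p2\mathrm{diag}(u))\}$; let $p^*_u=+\infty$ if $\max_i u_i\le 0$, and otherwise let $p^*_u=\sup\{q>0:\eta_{p,u}>0\text{ for all }p\in(0,q)\}$. Let $f:\mathbb R^n\times\mathbb S\to\mathbb R^n$ and $g:\mathbb R^n\times\mathbb S\to\mathbb R^{n\times d}$ be locally Lipschitz in the first variable, and suppose that there are $\bar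 p>0$, a symmetric positive definite matrix $Q\in\mathbb R^{n\times n}$ and $\alpha=(\alpha_1,\dots,\alpha_m)\in\mathbb R^m$ such that for every $i\in\mathbb S$ $$\limsup_{|x|\to\infty}\frac{(1+x^TQx)\,\psi(x,i)-(2-\bar p)\,|x^TQg(x,i)|^2}{(x^TQx)^2}\le\alpha_i,\qquad \psi(x,i)=2x^TQf(x,i)+\mathrm{trace}\big[g^T(x,i)Qg(x,i)\big],$$ and $\pi\alpha=\sum_i\pi_i\alpha_i<0$. Here $|\cdot|$ is the Euclidean norm of vectors and the trace norm $|A|=\sqrt{\mathrm{trace}(A^TA)}$ of matrices. Let $x_0\in\mathbb R^n$. For each $i$ let $\varphi_i:[1,\infty)\to[0,\infty)$ satisfy $\sup_{|x|\le u}\big(\frac{|f(x,i)|}{1+|x|}\vee\frac{|g(x,i)|^2}{(1+|x|)^2}\big)\le\varphi_i(u)$ for $u\ge 1$, where $\varphi_i$ is either continuous, strictly increasing and unbounded, with inverse $\varphi_i^{-1}$, or constant, in which case $\varphi_i^{-1}:=+\infty$. Let $0<\theta<\frac12$, let $K>0$, and let $h:(0,1]\to[\max_i\varphi_i(|x_0|\vee1),\infty)$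 be strictly decreasing with $\lim_{\Delta\to0}h(\Delta)=\infty$ and $\Delta^{1/2-\theta}h(\Delta)\le K$ for all $\Delta\in(0,1]$. With $\pi^i_\Delta(x)=\big(|x|\wedge\varphi_i^{-1}(h(\Delta))\big)\frac{x}{|x|}$ (and $\frac{x}{|x|}=0$ for $x=0$), $t_k=k\Delta$ and $r_k=r(t_k)$, the truncated Euler--Maruyama scheme with step $\Delta$ is $$\tilde Y_0=x_0,\qquad Y_k=\pi_\Delta^{r_k}(\tilde Y_k),\qquad \tilde Y_{k+1}=Y_k+f(Y_k,r_k)\Delta+g(Y_k,r_k)\big(B(t_{k+1})-B(t_k)\big),\qquad k\ge 0.$$ Then for every $p\in(0,p^*_\alpha)\cap(0,\bar p]$ there are $\Delta^*\in(0,1]$ and a constant $C$, independent of $k$ and $\Delta$, such that $$\sup_{0<\Delta\le\Delta^*}\ \sup_{k\ge0}\ \mathbb E|Y_k|^p\le C.$$ -/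

import Mathlib

open MeasureTheory ProbabilityTheory Filter Topology
open scoped NNReal Matrix

noncomputable section

namespace TruncatedEM

/-- `ℝⁿ` with its Euclidean norm. -/
abbrev Vec (n : ℕ) := EuclideanSpace ℝ (Fin n)

/-- The trace (Frobenius) norm `|A| = √(trace(AᵀA))`. -/
def traceNorm {n d : ℕ} (A : Matrix (Fin n) (Fin d) ℝ) : ℝ :=
  √((Aᵀ * A).trace)

/-! ### The driving processes -/

/-- `B` is a `d`-dimensional (standard) Brownian motion: it starts from `0`, has independent
increments, `B t - B s` has the law of `√(t - s) Z` with `Z` a standard Gaussian vector, and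
its paths are a.s. continuous. -/
structure IsBrownianMotion {Ω : Type*} [MeasurableSpace Ω] {d : ℕ}
    (B : ℝ≥0 → Ω → Vec d) (μ : Measure Ω) : Prop where
  measurable : ∀ t, Measurable (B t)
  start : ∀ᵐ ω ∂μ, B 0 ω = 0
  indepIncrements : HasIndepIncrements B μ
  law_increment : ∀ s t : ℝ≥0, s ≤ t →
    HasLaw (fun ω ↦ B t ω - B s ω)
      ((stdGaussian (Vec d)).map (fun z ↦ √((t : ℝ) - s) • z)) μ
  continuous_paths : ∀ᵐ ω ∂μ, Continuous (fun t ↦ B t ω)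

/-- `Γ` is the generator matrix of a continuous-time Markov chain: nonnegative off-diagonal
entries, and each diagonal entry is minus the sum of the other entries of its row. -/
def IsGenerator {m : ℕ} (Γ : Matrix (Fin m) (Fin m) ℝ) : Prop :=
  (∀ i j, i ≠ j → 0 ≤ Γ i j) ∧ ∀ i, ∑ j, Γ i j = 0

/-- `r` is a right-continuous (time-homogeneous) Markov chain on the state space `Fin m` with
generator `Γ`: there are transition probabilities `P t i j`, conditionally on the whole past up
to time `s`, for which `P δ i j = γ_ij δ + o(δ)` if `i ≠ j` and `P δ i i = 1 + γ_ii δ + o(δ)`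
as `δ ↓ 0`. -/
structure IsMarkovChain {Ω : Type*} [MeasurableSpace Ω] {m : ℕ}
    (r : ℝ≥0 → Ω → Fin m) (Γ : Matrix (Fin m) (Fin m) ℝ) (μ : Measure Ω) : Prop where
  measurable : ∀ t, Measurable (r t)
  rightContinuous : ∀ᵐ ω ∂μ, ∀ t, ContinuousWithinAt (fun s ↦ r s ω) (Set.Ici t) t
  transition : ∃ P : ℝ≥0 → Matrix (Fin m) (Fin m) ℝ,
    (∀ (s t : ℝ≥0) (A : Set Ω),
      MeasurableSet[⨆ u : Set.Iic s, MeasurableSpace.comap (r u) inferInstance] A →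
      ∀ i j, μ.real (A ∩ {ω | r s ω = i} ∩ {ω | r (s + t) ω = j}) =
        μ.real (A ∩ {ω | r s ω = i}) * P t i j) ∧
    ∀ i j, (fun δ : ℝ≥0 ↦ P δ i j - ((1 : Matrix (Fin m) (Fin m) ℝ) i j + Γ i j * δ))
      =o[𝓝[>] 0] (fun δ : ℝ≥0 ↦ (δ : ℝ))

/-- `ϖ` solves `ϖ Γ = 0`, `∑ ϖ_i = 1`. -/
def SolvesStationary {m : ℕ} (Γ : Matrix (Fin m) (Fin m) ℝ) (ϖ : Fin m → ℝ) : Prop :=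
  ϖ ᵥ* Γ = 0 ∧ ∑ i, ϖ i = 1

/-- The chain with generator `Γ` is irreducible with stationary distribution `ϖ`: the system
`ϖ Γ = 0`, `∑ ϖ_i = 1` has `ϖ` as its unique solution, and all `ϖ_i` are positive. -/
def IsIrreducibleWith {m : ℕ} (Γ : Matrix (Fin m) (Fin m) ℝ) (ϖ : Fin m → ℝ) : Prop :=
  SolvesStationary Γ ϖ ∧ (∀ ϖ', SolvesStationary Γ ϖ' → ϖ' = ϖ) ∧ ∀ i, 0 < ϖ i

/-! ### The exponents `η_{p,u}` and `p*_u` -/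

/-- `Γ_{p,u} = Γ + (p/2) diag(u)`. -/
def perturbed {m : ℕ} (Γ : Matrix (Fin m) (Fin m) ℝ) (p : ℝ) (u : Fin m → ℝ) :
    Matrix (Fin m) (Fin m) ℝ :=
  Γ + (p / 2) • Matrix.diagonal u

/-- `η_{p,u} = - max {Re ν : ν an eigenvalue of Γ_{p,u}}`. The spectrum is finite, and nonempty
for `m ≥ 1`, so that the supremum is a maximum. -/
def eta {m : ℕ} (Γ : Matrix (Fin m) (Fin m) ℝ) (p : ℝ) (u : Fin m → ℝ) : ℝ :=
  - sSup (Complex.re '' spectrum ℂ ((perturbed Γ p u).map (algebraMap ℝ ℂ)))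

open Classical in
/-- `p*_u`: it is `+∞` if all `u_i ≤ 0`; otherwise it is the threshold up to which `η_{p,u}` is
positive, i.e. the largest `q` such that `η_{p,u} > 0` for all `p ∈ (0, q)`. -/
def pStar {m : ℕ} (Γ : Matrix (Fin m) (Fin m) ℝ) (u : Fin m → ℝ) : EReal :=
  if ∀ i, u i ≤ 0 then ⊤
  else sSup ((fun q : ℝ ↦ (q : EReal)) '' {q : ℝ | 0 < q ∧ ∀ p ∈ Set.Ioo 0 q, 0 < eta Γ p u})

/-! ### Assumptions on the coefficients -/

/-- Local Lipschitz continuity of the drift `f` and the diffusion `g`. -/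
def LocallyLip {n d m : ℕ} (f : Vec n → Fin m → Vec n)
    (g : Vec n → Fin m → Matrix (Fin n) (Fin d) ℝ) : Prop :=
  ∀ N > (0 : ℝ), ∃ C > (0 : ℝ), ∀ x y : Vec n, ‖x‖ ≤ N → ‖y‖ ≤ N → ∀ i,
    ‖f x i - f y i‖ ≤ C * ‖x - y‖ ∧ traceNorm (g x i - g y i) ≤ C * ‖x - y‖

/-- The quadratic form `xᵀ Q x`. -/
def quad {n : ℕ} (Q : Matrix (Fin n) (Fin n) ℝ) (x : Vec n) : ℝ :=
  x.ofLp ⬝ᵥ Q *ᵥ x.ofLp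

/-- `ψ(x,i) = 2 xᵀ Q f(x,i) + trace(g(x,i)ᵀ Q g(x,i))`. -/
def psi {n d m : ℕ} (f : Vec n → Fin m → Vec n)
    (g : Vec n → Fin m → Matrix (Fin n) (Fin d) ℝ) (Q : Matrix (Fin n) (Fin n) ℝ)
    (x : Vec n) (i : Fin m) : ℝ :=
  2 * (x.ofLp ⬝ᵥ Q *ᵥ (f x i).ofLp) + ((g x i)ᵀ * Q * g x i).trace

/-- The growth condition in state `i`, with matrix `Q` and constant `a`:
`limsup_{|x| → ∞} [(1 + xᵀQx) ψ(x,i) - (2 - p̄) |xᵀ Q g(x,i)|²] / (xᵀQx)² ≤ a`. -/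
def GrowthCondition {n d m : ℕ} (f : Vec n → Fin m → Vec n)
    (g : Vec n → Fin m → Matrix (Fin n) (Fin d) ℝ) (Q : Matrix (Fin n) (Fin n) ℝ)
    (pbar : ℝ) (i : Fin m) (a : ℝ) : Prop :=
  limsup (fun x : Vec n ↦
      ((((1 + quad Q x) * psi f g Q x i
          - (2 - pbar) * ‖WithLp.toLp 2 (x.ofLp ᵥ* (Q * g x i))‖ ^ 2) / quad Q x ^ 2 : ℝ) : EReal))
    (Bornology.cobounded (Vec n)) ≤ (a : EReal)

/-! ### The truncated Euler–Maruyama scheme -/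

/-- `φ` (used on `[1, ∞)`) is constant. -/
def IsConstFrom1 (φ : ℝ → ℝ) : Prop := ∀ u, 1 ≤ u → φ u = φ 1

/-- `φ` is an admissible growth function for state `i`: it dominates
`sup_{|x| ≤ u} (|f(x,i)| / (1 + |x|)) ∨ (|g(x,i)|² / (1 + |x|)²)` for `u ≥ 1`, and on `[1, ∞)`
it is either continuous, strictly increasing and unbounded, or constant (the latter is possible
if the coefficients have linear growth in state `i`). -/
def IsGrowthFunction {n d m : ℕ} (f : Vec n → Fin m → Vec n)
    (g : Vec n → Fin m → Matrix (Fin n) (Fin d) ℝ) (i : Fin m) (φ : ℝ → ℝ) : Prop :=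
  (∀ u, 1 ≤ u → ∀ x : Vec n, ‖x‖ ≤ u →
    max (‖f x i‖ / (1 + ‖x‖)) (traceNorm (g x i) ^ 2 / (1 + ‖x‖) ^ 2) ≤ φ u) ∧
  ((StrictMonoOn φ (Set.Ici 1) ∧ ContinuousOn φ (Set.Ici 1) ∧ Tendsto φ atTop atTop) ∨
    IsConstFrom1 φ)

/-- `h : (0,1] → [max_i φ_i(|x₀| ∨ 1), ∞)` is strictly decreasing, tends to `∞` at `0`, and
`Δ^{1/2-θ} h(Δ) ≤ K` on `(0,1]`. -/
structure IsStepFunction {n m : ℕ} (φ : Fin m → ℝ → ℝ) (x₀ : Vec n) (θ K : ℝ)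
    (h : ℝ → ℝ) : Prop where
  lower : ∀ Δ ∈ Set.Ioc (0 : ℝ) 1, ∀ i, φ i (max ‖x₀‖ 1) ≤ h Δ
  strictAnti : StrictAntiOn h (Set.Ioc 0 1)
  tendsto : Tendsto h (𝓝[>] 0) atTop
  upper : ∀ Δ ∈ Set.Ioc (0 : ℝ) 1, Δ ^ (1 / 2 - θ) * h Δ ≤ K

open Classical in
/-- The truncation map `x ↦ (|x| ∧ φ⁻¹(v)) x/|x|`, where `φ⁻¹` is the inverse of `φ` on
`[1, ∞)`, and `φ⁻¹ = +∞` if `φ` is constant. -/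
def truncate {n : ℕ} (φ : ℝ → ℝ) (v : ℝ) (x : Vec n) : Vec n :=
  if IsConstFrom1 φ then x
  else min ‖x‖ (Function.invFunOn φ (Set.Ici 1) v) • (‖x‖⁻¹ • x)

/-- The untruncated iterates `Ỹ_k` of the scheme with step `Δ`:
`Ỹ_0 = x₀`, `Ỹ_{k+1} = Y_k + f(Y_k, r_k) Δ + g(Y_k, r_k) (B(t_{k+1}) - B(t_k))`, where
`t_k = kΔ`, `r_k = r(t_k)` and `Y_k` is the truncation of `Ỹ_k` in state `r_k`. -/
def emTilde {Ω : Type*} {n d m : ℕ} (f : Vec n → Fin m → Vec n)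
    (g : Vec n → Fin m → Matrix (Fin n) (Fin d) ℝ) (φ : Fin m → ℝ → ℝ) (h : ℝ → ℝ)
    (B : ℝ≥0 → Ω → Vec d) (r : ℝ≥0 → Ω → Fin m) (x₀ : Vec n) (Δ : ℝ≥0) :
    ℕ → Ω → Vec n
  | 0, _ => x₀
  | k + 1, ω =>
    let rk := r (k * Δ) ω
    let y := truncate (φ rk) (h Δ) (emTilde f g φ h B r x₀ Δ k ω)
    y + (Δ : ℝ) • f y rk
      + WithLp.toLp 2 (g y rk *ᵥ (B ((k + 1) * Δ) ω - B (k * Δ) ω).ofLp)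

/-- The truncated Euler–Maruyama iterates `Y_k`. -/
def em {Ω : Type*} {n d m : ℕ} (f : Vec n → Fin m → Vec n)
    (g : Vec n → Fin m → Matrix (Fin n) (Fin d) ℝ) (φ : Fin m → ℝ → ℝ) (h : ℝ → ℝ)
    (B : ℝ≥0 → Ω → Vec d) (r : ℝ≥0 → Ω → Fin m) (x₀ : Vec n) (Δ : ℝ≥0)
    (k : ℕ) (ω : Ω) : Vec n :=
  truncate (φ (r (k * Δ) ω)) (h Δ) (emTilde f g φ h B r x₀ Δ k ω)

end TruncatedEM

end

namespace TruncatedEM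

/-! ### A positive vector for a stable Metzler matrix -/

/-! The function `ξ_i (1 + xᵀQx)^(p/2)`, with suitable positive weights `ξ_i`, is a Lyapunov
function for the pair formed by the iterate and the chain: in each step its mean is multiplied by at
most `1 - κΔ`, up to an added constant of order `Δ`. Such a recursion is bounded uniformly in `k`
and `Δ`.

Weights (`exists_pos_vector`): below `p*_α` the matrix `Γ + (p/2) diag α` has no real eigenvalue in
`[0, ∞)`, either by the definition of `η` or, when `α ≤ 0`, by irreducibility and `πα < 0`. Its
off-diagonal entries are nonnegative, and for such a matrix this yields `ξ > 0` with `Γξ + (p/2) αξ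
= -1`.

One step (`exists_lintegral_step_le`): truncation gives the coefficients linear growth with constant
`H = h(Δ)`. Then `1 + xᵀQx` is multiplied by `1 + R + L`, where `L`, of size `√(HΔ)`, is odd in the
Gaussian variable and `R`, of size `HΔ`, is even. Averaging over `±ζ` removes the odd powers; the
term `L³` alone, of size `(HΔ)^(3/2)`, need not be `o(Δ)`. What remains is the generator term plus
an error `O((HΔ)²)`, which is `O(Δ^(1+2θ))` because `Δ^(1/2-θ) H ≤ K`. The growth condition bounds
the generator term, at the cost of a constant on a ball.

Switching (`lintegral_weighted_succ_le`): since chain and Brownian motion are independent, the chain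
path is frozen and the step estimate applied to the increments alone. The Markov property then
averages `ξ`, giving `ξ_i + Δ (Γξ)_i + o(Δ)`. Multiplied by `1 + Δ ((p/2) α_i + η)`, this has
first-order term `-1` up to small errors: the contraction. -/

theorem one_le_of_isMin {m : ℕ} {M : Matrix (Fin m) (Fin m) ℝ} (hM : ∀ i j, i ≠ j → 0 ≤ M i j)
    {s : ℝ} {ξ : Fin m → ℝ} (hξ : (s • (1 : Matrix (Fin m) (Fin m) ℝ) - M) *ᵥ ξ = 1)
    {i : Fin m} (hi : ∀ j, ξ i ≤ ξ j) : 1 ≤ (s - ∑ j, M i j) * ξ i := by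
  have h1 := congrFun hξ i
  rw [Matrix.sub_mulVec, Matrix.smul_mulVec, Matrix.one_mulVec] at h1
  simp only [Pi.sub_apply, Pi.smul_apply, smul_eq_mul, Pi.one_apply, Matrix.mulVec,
    dotProduct] at h1
  have h2 : ∑ j, M i j * ξ i ≤ ∑ j, M i j * ξ j := by
    refine Finset.sum_le_sum fun j _ ↦ ?_
    by_cases hij : i = j
    · subst hij; rfl
    · exact mul_le_mul_of_nonneg_left (hi j) (hM i j hij)
  rw [sub_mul, Finset.sum_mul]
  linarith

/-- A continuity argument along `ξ(s) = (s - M)⁻¹ 1`, `s ≥ 0`. At a smallest coordinate,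
`one_le_of_isMin` gives `1 ≤ (s - row sum) · min ξ(s)`, so the minimum never vanishes. It is
positive for large `s`, hence still positive at `s = 0`. -/
theorem exists_pos_mulVec_eq_neg_one {m : ℕ} (M : Matrix (Fin m) (Fin m) ℝ)
    (hM : ∀ i j, i ≠ j → 0 ≤ M i j)
    (hdet : ∀ s : ℝ, 0 ≤ s → (s • (1 : Matrix (Fin m) (Fin m) ℝ) - M).det ≠ 0) :
    ∃ ξ : Fin m → ℝ, (∀ i, 0 < ξ i) ∧ ∀ i, (M *ᵥ ξ) i = -1 := by
  rcases isEmpty_or_nonempty (Fin m) with hm | hm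
  · exact ⟨0, fun i ↦ hm.elim i, fun i ↦ hm.elim i⟩
  set A : ℝ → Matrix (Fin m) (Fin m) ℝ := fun s ↦ s • 1 - M with hA
  set ξ : ℝ → Fin m → ℝ := fun s ↦ (A s)⁻¹ *ᵥ 1 with hξdef
  have hAc : Continuous A := by fun_prop
  have hξ : ∀ s, 0 ≤ s → A s *ᵥ ξ s = 1 := by
    intro s hs
    have : IsUnit (A s).det := (hdet s hs).isUnit
    simp only [hξdef, Matrix.mulVec_mulVec, Matrix.mul_nonsing_inv _ this, Matrix.one_mulVec]
  have hcont : ∀ i, ContinuousOn (fun s ↦ ξ s i) (Set.Ici 0) := by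
    intro i
    have : (fun s ↦ ξ s i) = fun s ↦ (A s).det⁻¹ * ((A s).adjugate *ᵥ 1) i := by
      ext s
      simp only [hξdef, Matrix.inv_def, Matrix.smul_mulVec, Pi.smul_apply, smul_eq_mul,
        Ring.inverse_eq_inv']
    rw [this]
    refine ContinuousOn.mul (ContinuousOn.inv₀ hAc.matrix_det.continuousOn fun s hs ↦ hdet s hs) ?_
    have : Continuous fun s ↦ (A s).adjugate *ᵥ (1 : Fin m → ℝ) :=
      hAc.matrix_adjugate.matrix_mulVec continuous_const
    exact ((continuous_apply i).comp this).continuousOn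
  set μ : ℝ → ℝ := fun s ↦ Finset.univ.inf' Finset.univ_nonempty (fun i ↦ ξ s i) with hμ
  have hμc : ContinuousOn μ (Set.Ici 0) :=
    ContinuousOn.finset_inf'_apply Finset.univ_nonempty (fun i _ ↦ hcont i)
  have hkey : ∀ s, 0 ≤ s → ∃ i, 1 ≤ (s - ∑ j, M i j) * μ s := by
    intro s hs
    obtain ⟨i, -, hi⟩ := Finset.exists_mem_eq_inf' Finset.univ_nonempty (fun i ↦ ξ s i)
    refine ⟨i, ?_⟩
    have : μ s = ξ s i := hi
    rw [this]
    refine one_le_of_isMin hM (hξ s hs) fun j ↦ ?_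
    rw [← hi]
    exact Finset.inf'_le _ (Finset.mem_univ j)
  have hne : ∀ s, 0 ≤ s → μ s ≠ 0 := by
    intro s hs h0
    obtain ⟨i, hi⟩ := hkey s hs
    rw [h0, mul_zero] at hi
    linarith
  -- This `S` exceeds every row sum by at least `1`, which forces the minimum to be positive there.
  set S : ℝ := 1 + ∑ i, |∑ j, M i j| with hS
  have hS0 : 0 ≤ S := by positivity
  have hSpos : 0 < μ S := by
    obtain ⟨i, hi⟩ := hkey S hS0
    have h1 : |∑ j, M i j| ≤ ∑ i, |∑ j, M i j| :=
      Finset.single_le_sum (f := fun i ↦ |∑ j, M i j|) (fun _ _ ↦ abs_nonneg _) (Finset.mem_univ i)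
    have h2 := le_abs_self (∑ j, M i j)
    by_contra hneg
    push Not at hneg
    nlinarith
  have h0pos : 0 < μ 0 := by
    by_contra hneg
    push Not at hneg
    obtain ⟨s, hs, hs0⟩ := intermediate_value_Icc hS0 (hμc.mono Set.Icc_subset_Ici_self)
      (⟨hneg, hSpos.le⟩ : (0 : ℝ) ∈ Set.Icc (μ 0) (μ S))
    exact hne s hs.1 hs0
  refine ⟨ξ 0, fun i ↦ h0pos.trans_le (Finset.inf'_le _ (Finset.mem_univ i)), fun i ↦ ?_⟩
  have := congrFun (hξ 0 le_rfl) i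
  simp only [hA, zero_smul, zero_sub, Matrix.neg_mulVec, Pi.neg_apply, Pi.one_apply] at this
  linarith

/-! ### Real eigenvalues of `Γ + (p/2) diag u` -/

theorem det_ne_zero_of_eta_pos {m : ℕ} {Γ : Matrix (Fin m) (Fin m) ℝ} {p : ℝ} {u : Fin m → ℝ}
    (h : 0 < eta Γ p u) {s : ℝ} (hs : 0 ≤ s) :
    (s • (1 : Matrix (Fin m) (Fin m) ℝ) - perturbed Γ p u).det ≠ 0 := by
  intro hdet
  set N := (perturbed Γ p u).map (algebraMap ℝ ℂ) with hN
  have hmem : (s : ℂ) ∈ spectrum ℂ N := by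
    rw [spectrum.mem_iff, Matrix.isUnit_iff_isUnit_det]
    have : algebraMap ℂ (Matrix (Fin m) (Fin m) ℂ) s - N
        = (algebraMap ℝ ℂ).mapMatrix (s • (1 : Matrix (Fin m) (Fin m) ℝ) - perturbed Γ p u) := by
      ext i j
      by_cases hij : i = j
      · subst hij; simp [hN, Matrix.algebraMap_matrix_apply]
      · simp [hN, Matrix.algebraMap_matrix_apply, hij]
    rw [this, ← RingHom.map_det, hdet]
    simp
  have hfin : (Complex.re '' spectrum ℂ N).Finite := (Matrix.finite_spectrum N).image _
  have := le_csSup hfin.bddAbove ⟨_, hmem, rfl⟩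
  rw [Complex.ofReal_re] at this
  unfold eta at h
  linarith

/-- Expand the square: zero row sums kill the terms in `v i ^ 2`, stationarity kills those in `v j ^
2`, and only the cross terms survive. -/
theorem dirichlet_form {m : ℕ} {Γ : Matrix (Fin m) (Fin m) ℝ} (hΓ : IsGenerator Γ)
    {ϖ : Fin m → ℝ} (hϖ : ϖ ᵥ* Γ = 0) (v : Fin m → ℝ) :
    ∑ i, ∑ j, ϖ i * Γ i j * (v i - v j) ^ 2 = - 2 * ∑ i, ϖ i * (v i * (Γ *ᵥ v) i) := by
  have h1 : ∑ i, ∑ j, ϖ i * Γ i j * v i ^ 2 = 0 := by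
    refine Finset.sum_eq_zero fun i _ ↦ ?_
    have : ∑ j, ϖ i * Γ i j * v i ^ 2 = ϖ i * v i ^ 2 * ∑ j, Γ i j := by
      rw [Finset.mul_sum]; exact Finset.sum_congr rfl fun j _ ↦ by ring
    rw [this, hΓ.2 i, mul_zero]
  have h2 : ∑ i, ∑ j, ϖ i * Γ i j * v j ^ 2 = 0 := by
    rw [Finset.sum_comm]
    refine Finset.sum_eq_zero fun j _ ↦ ?_
    have h3 := congrFun hϖ j
    simp only [Matrix.vecMul, dotProduct, Pi.zero_apply] at h3
    rw [← Finset.sum_mul, h3, zero_mul]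
  have h3 : ∑ i, ∑ j, ϖ i * Γ i j * (v i - v j) ^ 2 =
      ∑ i, ∑ j, ϖ i * Γ i j * v i ^ 2 + ∑ i, ∑ j, ϖ i * Γ i j * v j ^ 2
        - 2 * ∑ i, ∑ j, ϖ i * Γ i j * (v i * v j) := by
    rw [Finset.mul_sum, ← Finset.sum_add_distrib, ← Finset.sum_sub_distrib]
    refine Finset.sum_congr rfl fun i _ ↦ ?_
    rw [Finset.mul_sum, ← Finset.sum_add_distrib, ← Finset.sum_sub_distrib]
    exact Finset.sum_congr rfl fun j _ ↦ by ring
  rw [h3, h1, h2]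
  have h4 : ∀ i, ∑ j, ϖ i * Γ i j * (v i * v j) = ϖ i * (v i * (Γ *ᵥ v) i) := by
    intro i
    simp only [Matrix.mulVec, dotProduct, Finset.mul_sum]
    exact Finset.sum_congr rfl fun j _ ↦ by ring
  simp only [h4]
  ring

/-- The case `p*_u = +∞`, where the definition says nothing about `η`. For a kernel vector `v`, the
Dirichlet form is nonnegative but equals `-2 ∑ ϖ_i (s - (p/2) u_i) v_i² ≤ 0`, so both vanish. Then
`v` is constant along transitions, hence constant by uniqueness of `ϖ`, and it vanishes at a state
with `u_i < 0`. -/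
theorem det_ne_zero_of_nonpos {m : ℕ} {Γ : Matrix (Fin m) (Fin m) ℝ} (hΓ : IsGenerator Γ)
    {ϖ : Fin m → ℝ} (hϖ : IsIrreducibleWith Γ ϖ) {u : Fin m → ℝ} (hu : ∀ i, u i ≤ 0)
    (hneg : ∑ i, ϖ i * u i < 0) {p : ℝ} (hp : 0 < p) {s : ℝ} (hs : 0 ≤ s) :
    (s • (1 : Matrix (Fin m) (Fin m) ℝ) - perturbed Γ p u).det ≠ 0 := by
  intro hdet
  obtain ⟨⟨hst, hsum⟩, huniq, hpos⟩ := hϖ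
  obtain ⟨v, hv0, hv⟩ := Matrix.exists_mulVec_eq_zero_iff.mpr hdet
  have hv' : ∀ i, (Γ *ᵥ v) i = (s - p / 2 * u i) * v i := by
    intro i
    have := congrFun hv i
    simp only [perturbed, Matrix.sub_mulVec, Matrix.add_mulVec, Matrix.smul_mulVec,
      Matrix.one_mulVec, Matrix.mulVec_diagonal, Pi.sub_apply, Pi.add_apply, Pi.smul_apply,
      smul_eq_mul, Pi.zero_apply] at this
    linarith
  have hD := dirichlet_form hΓ hst v
  have hterm : ∀ i j, 0 ≤ ϖ i * Γ i j * (v i - v j) ^ 2 := by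
    intro i j
    by_cases hij : i = j
    · subst hij; simp
    · exact mul_nonneg (mul_nonneg (hpos i).le (hΓ.1 i j hij)) (sq_nonneg _)
  have hterm2 : ∀ i, 0 ≤ ϖ i * (v i * (Γ *ᵥ v) i) := by
    intro i
    rw [hv' i]
    have : 0 ≤ s - p / 2 * u i := by nlinarith [hu i]
    have h2 : v i * ((s - p / 2 * u i) * v i) = (s - p / 2 * u i) * v i ^ 2 := by ring
    rw [h2]
    exact mul_nonneg (hpos i).le (mul_nonneg this (sq_nonneg _))
  have hs1 : 0 ≤ ∑ i, ∑ j, ϖ i * Γ i j * (v i - v j) ^ 2 :=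
    Finset.sum_nonneg fun i _ ↦ Finset.sum_nonneg fun j _ ↦ hterm i j
  have hs2 : 0 ≤ ∑ i, ϖ i * (v i * (Γ *ᵥ v) i) := Finset.sum_nonneg fun i _ ↦ hterm2 i
  have hz1 : ∑ i, ∑ j, ϖ i * Γ i j * (v i - v j) ^ 2 = 0 := by linarith
  have hz2 : ∑ i, ϖ i * (v i * (Γ *ᵥ v) i) = 0 := by linarith
  have hz1' : ∀ i j, ϖ i * Γ i j * (v i - v j) ^ 2 = 0 := by
    intro i j
    have h1 := (Finset.sum_eq_zero_iff_of_nonneg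
      (fun i _ ↦ Finset.sum_nonneg fun j _ ↦ hterm i j)).mp hz1 i (Finset.mem_univ i)
    exact (Finset.sum_eq_zero_iff_of_nonneg (fun j _ ↦ hterm i j)).mp h1 j (Finset.mem_univ j)
  have hz2' : ∀ i, ϖ i * (v i * (Γ *ᵥ v) i) = 0 := fun i ↦
    (Finset.sum_eq_zero_iff_of_nonneg (fun i _ ↦ hterm2 i)).mp hz2 i (Finset.mem_univ i)
  have hswap : ∀ i j, ϖ i * v i * Γ i j = v j * (ϖ i * Γ i j) := by
    intro i j
    rcases mul_eq_zero.mp (hz1' i j) with h | h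
    · linear_combination (v i - v j) * h
    · have : v i - v j = 0 := by simpa using h
      linear_combination ϖ i * Γ i j * this
  set c := ∑ i, ϖ i * v i with hc
  -- The vector `ϖ v` is invariant too. Only its mean-zero part is added to `ϖ`, so that the total
  -- mass stays `1` even if `c = 0`; no sign is needed.
  have hsol : SolvesStationary Γ (fun i ↦ ϖ i + (ϖ i * v i - c * ϖ i)) := by
    constructor
    · ext j
      have h3 := congrFun hst j
      simp only [Matrix.vecMul, dotProduct, Pi.zero_apply] at h3 ⊢
      have : ∀ i, (ϖ i + (ϖ i * v i - c * ϖ i)) * Γ i j = (1 + v j - c) * (ϖ i * Γ i j) := by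
        intro i
        linear_combination hswap i j
      simp only [this, ← Finset.mul_sum, h3, mul_zero]
    · rw [Finset.sum_add_distrib, Finset.sum_sub_distrib, ← Finset.mul_sum, hsum, ← hc]
      ring
  have hconst : ∀ i, v i = c := by
    intro i
    have := congrFun (huniq _ hsol) i
    have h3 : ϖ i * (v i - c) = 0 := by linarith
    rcases mul_eq_zero.mp h3 with h | h
    · exact absurd h (hpos i).ne'
    · linarith
  obtain ⟨i, -, hi⟩ : ∃ i ∈ Finset.univ, ϖ i * u i < 0 := by
    by_contra! hcon
    exact absurd (Finset.sum_nonneg hcon) (not_le.mpr hneg)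
  have hui : u i < 0 := by
    by_contra! hcon
    exact absurd (mul_nonneg (hpos i).le hcon) (not_le.mpr hi)
  have hvi : v i = 0 := by
    have h4 := hz2' i
    rw [hv' i] at h4
    have : 0 < s - p / 2 * u i := by nlinarith
    have h5 : ϖ i * (s - p / 2 * u i) * (v i) ^ 2 = 0 := by linarith
    rcases mul_eq_zero.mp h5 with h | h
    · exact absurd h (mul_pos (hpos i) this).ne'
    · simpa using h
  apply hv0
  ext j
  rw [hconst j, ← hconst i, hvi, Pi.zero_apply]

theorem exists_pos_vector {m : ℕ} {Γ : Matrix (Fin m) (Fin m) ℝ} (hΓ : IsGenerator Γ)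
    {ϖ : Fin m → ℝ} (hϖ : IsIrreducibleWith Γ ϖ) {u : Fin m → ℝ}
    (hneg : ∑ i, ϖ i * u i < 0) {p : ℝ} (hp : 0 < p) (hps : (p : EReal) < pStar Γ u) :
    ∃ ξ : Fin m → ℝ, (∀ i, 0 < ξ i) ∧ ∀ i, (Γ *ᵥ ξ) i + p / 2 * u i * ξ i = -1 := by
  have hdet : ∀ s : ℝ, 0 ≤ s →
      (s • (1 : Matrix (Fin m) (Fin m) ℝ) - perturbed Γ p u).det ≠ 0 := by
    intro s hs
    unfold pStar at hps
    split_ifs at hps with hu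
    · exact det_ne_zero_of_nonpos hΓ hϖ hu hneg hp hs
    · obtain ⟨_, ⟨q, ⟨-, hq⟩, rfl⟩, hlt⟩ := lt_sSup_iff.mp hps
      exact det_ne_zero_of_eta_pos (hq p ⟨hp, EReal.coe_lt_coe_iff.mp hlt⟩) hs
  have hoff : ∀ i j, i ≠ j → 0 ≤ perturbed Γ p u i j := by
    intro i j hij
    simpa [perturbed, hij] using hΓ.1 i j hij
  obtain ⟨ξ, hξ, h⟩ := exists_pos_mulVec_eq_neg_one _ hoff hdet
  refine ⟨ξ, hξ, fun i ↦ ?_⟩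
  rw [← h i]
  simp only [perturbed, Matrix.add_mulVec, Matrix.smul_mulVec, Matrix.mulVec_diagonal,
    Pi.add_apply, Pi.smul_apply, smul_eq_mul]
  ring

/-! ### A symmetrised Taylor estimate for `x ↦ (1 + x) ^ a` -/

/-- Binomial series to order four. The value of the cubic coefficient is irrelevant, since
symmetrisation removes its contribution `L³`. -/
theorem isBigO_one_add_rpow_sub_cubic (a : ℝ) : ∃ c : ℝ,
    (fun y : ℝ ↦ (1 + y) ^ a - (1 + a * y + a * (a - 1) / 2 * y ^ 2 + c * y ^ 3))
      =O[𝓝 0] fun y ↦ ‖y‖ ^ 4 := by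
  have h := (Real.one_add_rpow_hasFPowerSeriesAt_zero (a := a)).isBigO_sub_partialSum_pow 4
  refine ⟨Ring.choose a 3, ?_⟩
  have h2 : Ring.choose a 2 = a * (a - 1) / 2 := by
    have : (Polynomial.X * (Polynomial.X - 1) : Polynomial ℤ).smeval a = a * (a - 1) := by
      rw [← Polynomial.aeval_eq_smeval]
      simp
    simp [Ring.choose_eq_smul, descPochhammer_succ_right, this]
    ring
  refine h.congr_left fun y ↦ ?_
  simp only [binomialSeries, FormalMultilinearSeries.partialSum, Finset.sum_range_succ,
    Finset.range_zero, Finset.sum_empty, FormalMultilinearSeries.ofScalars_apply_eq, smul_eq_mul,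
    h2, Ring.choose_zero_right, Ring.choose_one_right]
  ring_nf

/-- Near `0` this is the Taylor bound. For `|y| ≥ r` the power `(1 + y)^a` is dominated by `y^(2N)`
with `2N ≥ a`, and the polynomial by `y⁴`. A polynomial error in `y` has finite Gaussian moments. -/
theorem exists_one_add_rpow_le {a : ℝ} (ha : 0 ≤ a) : ∃ c C : ℝ, ∃ N : ℕ, 0 ≤ C ∧ 2 ≤ N ∧
    ∀ y : ℝ, 0 < 1 + y → (1 + y) ^ a ≤
      1 + a * y + a * (a - 1) / 2 * y ^ 2 + c * y ^ 3 + C * (y ^ 4 + (y ^ 2) ^ N) := by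
  obtain ⟨c, hc⟩ := isBigO_one_add_rpow_sub_cubic a
  obtain ⟨K, hK0, hK⟩ := hc.exists_nonneg
  obtain ⟨r', hr', hball⟩ := Metric.eventually_nhds_iff.mp hK.bound
  set r := min r' (1 / 2) with hrdef
  have hr : 0 < r := lt_min hr' (by norm_num)
  obtain ⟨N₀, hN₀⟩ := exists_nat_ge a
  set N := N₀ + 2 with hN
  -- For `|y| ≥ r` one has `|y|^k ≤ y⁴ / r^(4-k)`; `D` collects `k = 0, 1, 2, 3`, while `E` below
  -- comes from `1 + |y| ≤ (1/r + 1) |y|`.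
  set D := 1 / r ^ 4 + |a| / r ^ 3 + |a * (a - 1) / 2| / r ^ 2 + |c| / r with hD
  have hD0 : 0 ≤ D := by positivity
  set E := (1 / r + 1) ^ (2 * N) with hE
  have hE0 : 0 ≤ E := by positivity
  refine ⟨c, K + D + E, N, by positivity, by omega, fun y hy ↦ ?_⟩
  have hy4 : 0 ≤ y ^ 4 := by positivity
  have hyN : 0 ≤ (y ^ 2) ^ N := by positivity
  by_cases hyr : |y| < r
  · have h1 := hball (y := y) (by simpa using hyr.trans_le (min_le_left _ _))
    have h2 := (le_abs_self _).trans h1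
    have h3 : ‖‖y‖ ^ 4‖ = y ^ 4 := by
      rw [norm_pow, norm_norm, Real.norm_eq_abs]
      exact Even.pow_abs (by decide) y
    rw [h3] at h2
    have : K * y ^ 4 ≤ (K + D + E) * (y ^ 4 + (y ^ 2) ^ N) := by
      apply mul_le_mul <;> linarith
    linarith
  · push Not at hyr
    have hypos : 0 < |y| := hr.trans_le hyr
    have h1 : (1 + y) ^ a ≤ E * (y ^ 2) ^ N := by
      have hb : 1 + y ≤ 1 + |y| := by linarith [le_abs_self y]
      have hle : 1 + |y| ≤ (1 / r + 1) * |y| := by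
        have : 1 ≤ 1 / r * |y| := by
          rw [one_div, inv_mul_eq_div, le_div_iff₀ hr]; linarith
        linarith
      have hpow : (1 + |y|) ^ (2 * N) ≤ E * (y ^ 2) ^ N := by
        calc (1 + |y|) ^ (2 * N) ≤ ((1 / r + 1) * |y|) ^ (2 * N) :=
              pow_le_pow_left₀ (by positivity) hle _
          _ = E * (y ^ 2) ^ N := by rw [mul_pow, hE, pow_mul |y| 2 N, sq_abs]
      refine le_trans ?_ hpow
      calc (1 + y) ^ a ≤ (1 + |y|) ^ a := Real.rpow_le_rpow hy.le hb ha
        _ ≤ (1 + |y|) ^ ((2 * N : ℕ) : ℝ) :=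
            Real.rpow_le_rpow_of_exponent_le (by linarith) (by
              push_cast [hN]
              have : (0 : ℝ) ≤ N₀ := Nat.cast_nonneg _
              linarith)
        _ = _ := Real.rpow_natCast _ _
    have hmono : ∀ k : ℕ, k ≤ 4 → |y| ^ k ≤ y ^ 4 / r ^ (4 - k) := by
      intro k hk
      rw [le_div_iff₀ (by positivity)]
      calc |y| ^ k * r ^ (4 - k) ≤ |y| ^ k * |y| ^ (4 - k) :=
            mul_le_mul_of_nonneg_left (pow_le_pow_left₀ hr.le hyr _) (by positivity)
        _ = |y| ^ 4 := by rw [← pow_add, Nat.add_sub_cancel' hk]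
        _ = y ^ 4 := Even.pow_abs (by decide) y
    have h2 : -(1 + a * y + a * (a - 1) / 2 * y ^ 2 + c * y ^ 3) ≤ D * y ^ 4 := by
      have e0 := hmono 0 (by norm_num)
      have e1 := mul_le_mul_of_nonneg_left (hmono 1 (by norm_num)) (abs_nonneg a)
      have e2 := mul_le_mul_of_nonneg_left (hmono 2 (by norm_num)) (abs_nonneg (a * (a - 1) / 2))
      have e3 := mul_le_mul_of_nonneg_left (hmono 3 (by norm_num)) (abs_nonneg c)
      rw [← abs_pow, ← abs_mul] at e1 e2 e3
      have g1 := neg_abs_le (a * y ^ 1)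
      have g2 := neg_abs_le (a * (a - 1) / 2 * y ^ 2)
      have g3 := neg_abs_le (c * y ^ 3)
      have : D * y ^ 4 = y ^ 4 / r ^ (4 - 0) + |a| * (y ^ 4 / r ^ (4 - 1)) +
          |a * (a - 1) / 2| * (y ^ 4 / r ^ (4 - 2)) + |c| * (y ^ 4 / r ^ (4 - 3)) := by
        simp only [hD]
        norm_num
        ring
      rw [this]
      simp only [pow_zero, pow_one] at *
      linarith
    have h3 : D * y ^ 4 + E * (y ^ 2) ^ N ≤ (K + D + E) * (y ^ 4 + (y ^ 2) ^ N) := by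
      nlinarith [mul_nonneg hK0 hy4, mul_nonneg hK0 hyN, mul_nonneg hD0 hyN, mul_nonneg hE0 hy4]
    linarith

theorem pow_le_sq_add_pow {t : ℝ} (ht : 0 ≤ t) {k N : ℕ} (h2 : 2 ≤ k) (hk : k ≤ 2 * N) :
    t ^ k ≤ t ^ 2 + t ^ (2 * N) := by
  rcases le_total t 1 with h | h
  · exact (pow_le_pow_of_le_one ht h h2).trans (le_add_of_nonneg_right (by positivity))
  · exact (pow_le_pow_right₀ h hk).trans (le_add_of_nonneg_left (by positivity))

/-- If `L` and `R` have sizes `√t` and `t`, then the average of `(1 + R ± L) ^ a` is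
`1 + aR + a(a-1)/2 L²` up to `t²`, since the odd powers of `L` cancel. -/
theorem exists_symm_rpow_le {a : ℝ} (ha : 0 ≤ a) : ∃ C : ℝ, ∃ N : ℕ, 0 ≤ C ∧ 2 ≤ N ∧
    ∀ t L R : ℝ, L ^ 2 ≤ t → |R| ≤ t → 0 < 1 + (R + L) → 0 < 1 + (R - L) →
      ((1 + (R + L)) ^ a + (1 + (R - L)) ^ a) / 2 ≤
        1 + a * R + a * (a - 1) / 2 * L ^ 2 + C * (t ^ 2 + t ^ (2 * N)) := by
  obtain ⟨c, C, N, hC, hN, h⟩ := exists_one_add_rpow_le ha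
  -- The three parts pay for `R²`, for `R³ + 3RL²`, and for the remainder, where `(R ± L)² ≤ 2(t² +
  -- t)`.
  refine ⟨|a * (a - 1) / 2| + |c| * 4 + C * (16 + 4 ^ N * 2), N, by positivity, hN,
    fun t L R hL hR hp hm ↦ ?_⟩
  have ht : 0 ≤ t := (abs_nonneg R).trans hR
  set T := t ^ 2 + t ^ (2 * N) with hT
  have hT0 : 0 ≤ T := by positivity
  have hpow : ∀ k, 2 ≤ k → k ≤ 2 * N → t ^ k ≤ T := fun k h2 hk ↦ pow_le_sq_add_pow ht h2 hk
  have hR2 : R ^ 2 ≤ T := by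
    have : R ^ 2 ≤ t ^ 2 := sq_le_sq' (by linarith [neg_abs_le R]) (by linarith [le_abs_self R])
    exact this.trans (hpow 2 le_rfl (by omega))
  have hR3 : |R ^ 3| ≤ T := by
    rw [abs_pow]
    exact (pow_le_pow_left₀ (abs_nonneg R) hR 3).trans (hpow 3 (by omega) (by omega))
  have hRL : |R * L ^ 2| ≤ T := by
    rw [abs_mul, abs_of_nonneg (sq_nonneg L)]
    calc |R| * L ^ 2 ≤ t * t := mul_le_mul hR hL (sq_nonneg L) ht
      _ = t ^ 2 := by ring
      _ ≤ T := hpow 2 le_rfl (by omega)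
  have hR2' : R ^ 2 ≤ t ^ 2 := sq_le_sq' (by linarith [neg_abs_le R]) (by linarith [le_abs_self R])
  have hsq : ∀ x : ℝ, x ^ 2 ≤ 2 * (t ^ 2 + t) → x ^ 4 + (x ^ 2) ^ N ≤ (16 + 4 ^ N * 2) * T := by
    intro x hx
    have hb : 0 ≤ 2 * (t ^ 2 + t) := by positivity
    have hadd : ∀ k, 2 ≤ k → k ≤ N → (2 * (t ^ 2 + t)) ^ k ≤ 4 ^ k * (2 * T) := by
      intro k hk hkN
      have h1 : (t ^ 2 + t) ^ k ≤ 2 ^ k * (t ^ (2 * k) + t ^ k) := by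
        rw [pow_mul]
        refine (add_pow_le (by positivity) ht k).trans ?_
        exact mul_le_mul_of_nonneg_right (pow_le_pow_right₀ (by norm_num) (by omega))
          (by positivity)
      have h2 := hpow (2 * k) (by omega) (by omega)
      have h3 := hpow k hk (by omega)
      calc (2 * (t ^ 2 + t)) ^ k = 2 ^ k * (t ^ 2 + t) ^ k := mul_pow _ _ _
        _ ≤ 2 ^ k * (2 ^ k * (2 * T)) := by
            gcongr
            exact h1.trans (mul_le_mul_of_nonneg_left (by linarith) (by positivity))
        _ = 4 ^ k * (2 * T) := by
            rw [← mul_assoc, ← mul_pow]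
            norm_num
    have h4 : x ^ 4 ≤ 16 * T := by
      have : x ^ 4 ≤ 4 * (t ^ 2 + t) ^ 2 := by
        calc x ^ 4 = (x ^ 2) ^ 2 := by ring
          _ ≤ (2 * (t ^ 2 + t)) ^ 2 := pow_le_pow_left₀ (sq_nonneg x) hx 2
          _ = _ := by ring
      have h5 := hpow 2 le_rfl (by omega)
      have h6 := hpow 3 (by omega) (by omega)
      have h7 := hpow 4 (by omega) (by omega)
      nlinarith
    have hN' : (x ^ 2) ^ N ≤ 4 ^ N * (2 * T) :=
      (pow_le_pow_left₀ (sq_nonneg x) hx N).trans (hadd N hN le_rfl)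
    linarith
  have hu := mul_le_mul_of_nonneg_left
    (hsq (R + L) (by nlinarith [sq_nonneg (R - L)])) hC
  have hv := mul_le_mul_of_nonneg_left
    (hsq (R - L) (by nlinarith [sq_nonneg (R + L)])) hC
  have e1 := h (R + L) hp
  have e2 := h (R - L) hm
  have g1 : a * (a - 1) / 2 * R ^ 2 ≤ |a * (a - 1) / 2| * T :=
    mul_le_mul (le_abs_self _) hR2 (sq_nonneg R) (abs_nonneg _)
  have g2 : c * R ^ 3 ≤ |c| * T := by
    refine (le_abs_self _).trans ?_
    rw [abs_mul]
    exact mul_le_mul_of_nonneg_left hR3 (abs_nonneg c)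
  have g3 : c * (R * L ^ 2) ≤ |c| * T := by
    refine (le_abs_self _).trans ?_
    rw [abs_mul]
    exact mul_le_mul_of_nonneg_left hRL (abs_nonneg c)
  nlinarith

/-! ### Moments of the standard Gaussian vector -/

theorem integrable_norm_pow_stdGaussian (d k : ℕ) :
    Integrable (fun ζ : Vec d ↦ ‖ζ‖ ^ k) (stdGaussian (Vec d)) :=
  (IsGaussian.memLp_id (stdGaussian (Vec d)) k (by simp)).integrable_norm_pow'

theorem integrable_one_add_norm_sq_pow_stdGaussian (d k : ℕ) :
    Integrable (fun ζ : Vec d ↦ (1 + ‖ζ‖ ^ 2) ^ k) (stdGaussian (Vec d)) := by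
  simp_rw [add_pow, one_pow, one_mul, ← pow_mul]
  exact integrable_finsetSum _ fun i _ ↦ (integrable_norm_pow_stdGaussian d _).mul_const _

theorem map_neg_stdGaussian (d : ℕ) :
    (stdGaussian (Vec d)).map (fun ζ ↦ -ζ) = stdGaussian (Vec d) :=
  stdGaussian_map (LinearIsometryEquiv.neg ℝ (E := Vec d))

theorem integrable_coord_mul_coord_stdGaussian {d : ℕ} (i j : Fin d) :
    Integrable (fun ζ : Vec d ↦ ζ i * ζ j) (stdGaussian (Vec d)) := by
  refine (integrable_norm_pow_stdGaussian d 2).mono' (by fun_prop) (ae_of_all _ fun ζ ↦ ?_)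
  rw [norm_mul, sq]
  exact mul_le_mul (PiLp.norm_apply_le ζ i) (PiLp.norm_apply_le ζ j) (norm_nonneg _)
    (norm_nonneg _)

theorem integral_coord_mul_coord_stdGaussian {d : ℕ} (i j : Fin d) :
    ∫ ζ : Vec d, ζ i * ζ j ∂stdGaussian (Vec d) = (1 : Matrix (Fin d) (Fin d) ℝ) i j := by
  have h := covariance_eval_multivariateGaussian (μ := (0 : Vec d)) (S := 1)
    Matrix.PosSemidef.one i j
  rw [multivariateGaussian_zero_one] at h
  have hz : ∀ k : Fin d, ∫ ζ : Vec d, ζ k ∂stdGaussian (Vec d) = 0 := fun k ↦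
    integral_strongDual_stdGaussian (EuclideanSpace.proj k : Vec d →L[ℝ] ℝ)
  rw [← h, covariance]
  simp [hz]

theorem dotProduct_mulVec_eq_sum {d : ℕ} (A : Matrix (Fin d) (Fin d) ℝ) (x : Fin d → ℝ) :
    x ⬝ᵥ A *ᵥ x = ∑ i, ∑ j, x i * x j * A i j := by
  simp only [dotProduct, Matrix.mulVec, Finset.mul_sum]
  exact Finset.sum_congr rfl fun i _ ↦ Finset.sum_congr rfl fun j _ ↦ by ring

theorem integrable_dotProduct_mulVec_stdGaussian {d : ℕ} (A : Matrix (Fin d) (Fin d) ℝ) :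
    Integrable (fun ζ : Vec d ↦ ζ.ofLp ⬝ᵥ A *ᵥ ζ.ofLp) (stdGaussian (Vec d)) := by
  simp_rw [dotProduct_mulVec_eq_sum]
  exact integrable_finsetSum _ fun i _ ↦ integrable_finsetSum _ fun j _ ↦
    (integrable_coord_mul_coord_stdGaussian i j).mul_const _

theorem integral_dotProduct_mulVec_stdGaussian {d : ℕ} (A : Matrix (Fin d) (Fin d) ℝ) :
    ∫ ζ : Vec d, ζ.ofLp ⬝ᵥ A *ᵥ ζ.ofLp ∂stdGaussian (Vec d) = A.trace := by
  have hint : ∀ i j, Integrable (fun ζ : Vec d ↦ ζ i * ζ j * A i j) (stdGaussian (Vec d)) :=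
    fun i j ↦ (integrable_coord_mul_coord_stdGaussian i j).mul_const _
  simp_rw [dotProduct_mulVec_eq_sum]
  refine (integral_finsetSum _ fun i _ ↦ integrable_finsetSum _ fun j _ ↦ hint i j).trans ?_
  refine Finset.sum_congr rfl fun i _ ↦ ?_
  refine (integral_finsetSum _ fun j _ ↦ hint i j).trans ?_
  simp_rw [integral_mul_const, integral_coord_mul_coord_stdGaussian]
  simp [Matrix.one_apply]

/-- A squared linear form is a rank-one quadratic form, so its Gaussian mean is again a trace. -/
theorem inner_sq_eq_dotProduct {d : ℕ} (u ζ : Vec d) :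
    inner ℝ u ζ ^ 2 = ζ.ofLp ⬝ᵥ Matrix.vecMulVec u.ofLp u.ofLp *ᵥ ζ.ofLp := by
  rw [Matrix.vecMulVec_mulVec, EuclideanSpace.inner_eq_star_dotProduct]
  simp [dotProduct_comm, sq]

theorem integrable_inner_sq_stdGaussian {d : ℕ} (u : Vec d) :
    Integrable (fun ζ : Vec d ↦ inner ℝ u ζ ^ 2) (stdGaussian (Vec d)) := by
  simp_rw [inner_sq_eq_dotProduct]
  exact integrable_dotProduct_mulVec_stdGaussian _

theorem integral_inner_sq_stdGaussian {d : ℕ} (u : Vec d) :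
    ∫ ζ : Vec d, inner ℝ u ζ ^ 2 ∂stdGaussian (Vec d) = ‖u‖ ^ 2 := by
  simp_rw [inner_sq_eq_dotProduct]
  rw [integral_dotProduct_mulVec_stdGaussian, Matrix.trace_vecMulVec, EuclideanSpace.norm_sq_eq]
  simp [dotProduct, sq]

/-! ### The bilinear form `xᵀ Q y` -/

/-- The bilinear form `xᵀ Q y`. -/
def bil {n : ℕ} (Q : Matrix (Fin n) (Fin n) ℝ) (x y : Vec n) : ℝ :=
  x.ofLp ⬝ᵥ Q *ᵥ y.ofLp

section bil
variable {n : ℕ} {Q : Matrix (Fin n) (Fin n) ℝ}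

theorem quad_eq_bil (x : Vec n) : quad Q x = bil Q x x := rfl

theorem bil_add_left (x y z : Vec n) : bil Q (x + y) z = bil Q x z + bil Q y z := by
  simp [bil, add_dotProduct]

theorem bil_add_right (x y z : Vec n) : bil Q x (y + z) = bil Q x y + bil Q x z := by
  simp [bil, Matrix.mulVec_add, dotProduct_add]

theorem bil_smul_left (c : ℝ) (x y : Vec n) : bil Q (c • x) y = c * bil Q x y := by
  simp [bil, smul_dotProduct]

theorem bil_smul_right (c : ℝ) (x y : Vec n) : bil Q x (c • y) = c * bil Q x y := by
  simp [bil, Matrix.mulVec_smul, dotProduct_smul]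

theorem bil_comm (hQ : Q.PosDef) (x y : Vec n) : bil Q x y = bil Q y x := by
  have hT : Qᵀ = Q := by simpa using hQ.isHermitian.eq
  unfold bil
  rw [Matrix.dotProduct_mulVec, dotProduct_comm, ← Matrix.mulVec_transpose, hT]

theorem quad_smul (c : ℝ) (x : Vec n) : quad Q (c • x) = c ^ 2 * quad Q x := by
  rw [quad_eq_bil, bil_smul_left, bil_smul_right, quad_eq_bil]
  ring

theorem quad_add (hQ : Q.PosDef) (x y : Vec n) :
    quad Q (x + y) = quad Q x + 2 * bil Q x y + quad Q y := by
  simp only [quad_eq_bil, bil_add_left, bil_add_right, bil_comm hQ y x]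
  ring

theorem quad_nonneg (hQ : Q.PosDef) (x : Vec n) : 0 ≤ quad Q x := by
  simpa [quad] using hQ.posSemidef.dotProduct_mulVec_nonneg x.ofLp

theorem exists_abs_bil_le (Q : Matrix (Fin n) (Fin n) ℝ) :
    ∃ Λ : ℝ, 0 ≤ Λ ∧ ∀ x y : Vec n, |bil Q x y| ≤ Λ * (‖x‖ * ‖y‖) := by
  refine ⟨‖Matrix.toEuclideanCLM (𝕜 := ℝ) Q‖, norm_nonneg _, fun x y ↦ ?_⟩
  have h : bil Q x y = inner ℝ x (Matrix.toEuclideanCLM (𝕜 := ℝ) Q y) := by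
    rw [Matrix.inner_toEuclideanCLM]
    simp [bil]
  rw [h]
  refine (abs_real_inner_le_norm _ _).trans ?_
  calc ‖x‖ * ‖Matrix.toEuclideanCLM (𝕜 := ℝ) Q y‖
      ≤ ‖x‖ * (‖Matrix.toEuclideanCLM (𝕜 := ℝ) Q‖ * ‖y‖) :=
        mul_le_mul_of_nonneg_left (ContinuousLinearMap.le_opNorm _ _) (norm_nonneg _)
    _ = _ := by ring

theorem continuous_quad : Continuous (quad Q) := by
  unfold quad
  fun_prop

theorem exists_le_quad (hQ : Q.PosDef) : ∃ c : ℝ, 0 < c ∧ ∀ x : Vec n, c * ‖x‖ ^ 2 ≤ quad Q x := by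
  -- The sphere is empty only when `n = 0`; otherwise the minimum of the form on the sphere serves
  -- as constant.
  rcases (Metric.sphere (0 : Vec n) 1).eq_empty_or_nonempty with h | h
  · refine ⟨1, one_pos, fun x ↦ ?_⟩
    have hx : x = 0 := by
      by_contra hx
      have : ‖x‖⁻¹ • x ∈ Metric.sphere (0 : Vec n) 1 := by
        simp [norm_smul, hx]
      rw [h] at this
      exact this
    simp [hx, quad]
  · obtain ⟨x₀, hx₀, hmin⟩ :=
      (isCompact_sphere (0 : Vec n) 1).exists_isMinOn h (continuous_quad (Q := Q)).continuousOn
    have hx₀0 : x₀ ≠ 0 := by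
      rintro rfl
      simp at hx₀
    refine ⟨quad Q x₀, ?_, fun x ↦ ?_⟩
    · have : x₀.ofLp ≠ 0 := fun h0 ↦ hx₀0 (by ext i; simp [h0])
      simpa [quad] using hQ.dotProduct_mulVec_pos this
    · by_cases hx : x = 0
      · simp [hx, quad]
      have hn : 0 < ‖x‖ := norm_pos_iff.mpr hx
      have h1 : quad Q x₀ ≤ quad Q (‖x‖⁻¹ • x) := hmin (by simp [norm_smul, hx])
      rw [quad_smul] at h1
      calc quad Q x₀ * ‖x‖ ^ 2 ≤ (‖x‖⁻¹ ^ 2 * quad Q x) * ‖x‖ ^ 2 :=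
            mul_le_mul_of_nonneg_right h1 (by positivity)
        _ = quad Q x := by field_simp

theorem exists_le_one_add_quad (hQ : Q.PosDef) :
    ∃ c : ℝ, 0 < c ∧ ∀ x : Vec n, c * (1 + ‖x‖) ^ 2 ≤ 1 + quad Q x := by
  obtain ⟨c, hc, h⟩ := exists_le_quad hQ
  refine ⟨min 1 c / 2, by positivity, fun x ↦ ?_⟩
  have h1 : min 1 c ≤ 1 := min_le_left _ _
  have h2 : min 1 c ≤ c := min_le_right _ _
  have h3 := h x
  have h4 : 0 < min 1 c := by positivity
  have h5 : (1 + ‖x‖) ^ 2 ≤ 2 * (1 + ‖x‖ ^ 2) := by nlinarith [sq_nonneg (1 - ‖x‖)]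
  nlinarith [mul_le_mul_of_nonneg_right h2 (sq_nonneg ‖x‖)]

end bil

/-! ### The image of a vector under a matrix -/

theorem traceNorm_sq {n d : ℕ} (A : Matrix (Fin n) (Fin d) ℝ) :
    traceNorm A ^ 2 = ∑ i, ∑ j, A i j ^ 2 := by
  have h : (Aᵀ * A).trace = ∑ i, ∑ j, A i j ^ 2 := by
    rw [Finset.sum_comm]
    simp [Matrix.trace, Matrix.mul_apply, sq]
  rw [traceNorm, Real.sq_sqrt, h]
  rw [h]
  positivity

theorem norm_mulVec_sq_le {n d : ℕ} (A : Matrix (Fin n) (Fin d) ℝ) (ζ : Vec d) :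
    ‖(WithLp.toLp 2 (A *ᵥ ζ.ofLp) : Vec n)‖ ^ 2 ≤ traceNorm A ^ 2 * ‖ζ‖ ^ 2 := by
  rw [EuclideanSpace.norm_sq_eq, EuclideanSpace.norm_sq_eq, traceNorm_sq, Finset.sum_mul]
  refine Finset.sum_le_sum fun i _ ↦ ?_
  simp only [Matrix.mulVec, dotProduct, Real.norm_eq_abs, sq_abs]
  exact Finset.sum_mul_sq_le_sq_mul_sq _ _ _

theorem bil_mulVec {n d : ℕ} (Q : Matrix (Fin n) (Fin n) ℝ) (G : Matrix (Fin n) (Fin d) ℝ)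
    (x : Vec n) (ζ : Vec d) :
    bil Q x (WithLp.toLp 2 (G *ᵥ ζ.ofLp)) =
      inner ℝ (WithLp.toLp 2 (x.ofLp ᵥ* (Q * G)) : Vec d) ζ := by
  rw [EuclideanSpace.inner_eq_star_dotProduct]
  simp only [bil, star_trivial]
  rw [Matrix.mulVec_mulVec, Matrix.dotProduct_mulVec, dotProduct_comm]

theorem quad_mulVec {n d : ℕ} (Q : Matrix (Fin n) (Fin n) ℝ) (G : Matrix (Fin n) (Fin d) ℝ)
    (ζ : Vec d) :
    quad Q (WithLp.toLp 2 (G *ᵥ ζ.ofLp)) = ζ.ofLp ⬝ᵥ (Gᵀ * Q * G) *ᵥ ζ.ofLp := by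
  simp only [quad]
  rw [Matrix.mulVec_mulVec, Matrix.dotProduct_mulVec, Matrix.dotProduct_mulVec,
    ← Matrix.vecMul_transpose, Matrix.vecMul_vecMul, Matrix.mul_assoc]

/-- Duality: with `β` the vector on the left, `‖β‖² = xᵀQ(Gβ)`, and one factor `‖β‖` cancels. -/
theorem norm_vecMul_le {n d : ℕ} {Q : Matrix (Fin n) (Fin n) ℝ} {Λ : ℝ}
    (hΛ : ∀ x y : Vec n, |bil Q x y| ≤ Λ * (‖x‖ * ‖y‖)) (hΛ0 : 0 ≤ Λ)
    (G : Matrix (Fin n) (Fin d) ℝ) (x : Vec n) :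
    ‖(WithLp.toLp 2 (x.ofLp ᵥ* (Q * G)) : Vec d)‖ ≤ Λ * ‖x‖ * traceNorm G := by
  set β : Vec d := WithLp.toLp 2 (x.ofLp ᵥ* (Q * G)) with hβ
  have hG : 0 ≤ traceNorm G := Real.sqrt_nonneg _
  have h1 : ‖β‖ ^ 2 ≤ Λ * ‖x‖ * traceNorm G * ‖β‖ := by
    rw [← real_inner_self_eq_norm_sq, hβ, ← bil_mulVec, ← hβ]
    refine (le_abs_self _).trans ((hΛ _ _).trans ?_)
    have : ‖(WithLp.toLp 2 (G *ᵥ β.ofLp) : Vec n)‖ ≤ traceNorm G * ‖β‖ := by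
      refine le_of_sq_le_sq ?_ (by positivity)
      rw [mul_pow]
      exact norm_mulVec_sq_le G β
    calc Λ * (‖x‖ * ‖(WithLp.toLp 2 (G *ᵥ β.ofLp) : Vec n)‖)
        ≤ Λ * (‖x‖ * (traceNorm G * ‖β‖)) := by gcongr
      _ = _ := by ring
  rcases (norm_nonneg β).eq_or_lt with h | h
  · rw [← h]; positivity
  · rw [sq] at h1
    exact le_of_mul_le_mul_right h1 h

/-! ### One step of the Euler–Maruyama scheme -/

/-- The part of `(1 + |y + Δ v + √Δ G ζ|²_Q) / (1 + |y|²_Q) - 1` that is odd in `ζ`. -/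
noncomputable def oddPart {n d : ℕ} (Q : Matrix (Fin n) (Fin n) ℝ) (Δ : ℝ) (y v : Vec n)
    (G : Matrix (Fin n) (Fin d) ℝ) (ζ : Vec d) : ℝ :=
  2 * √Δ * bil Q (y + Δ • v) (WithLp.toLp 2 (G *ᵥ ζ.ofLp)) / (1 + quad Q y)

/-- The part of `(1 + |y + Δ v + √Δ G ζ|²_Q) / (1 + |y|²_Q) - 1` that is even in `ζ`. -/
noncomputable def evenPart {n d : ℕ} (Q : Matrix (Fin n) (Fin n) ℝ) (Δ : ℝ) (y v : Vec n)
    (G : Matrix (Fin n) (Fin d) ℝ) (ζ : Vec d) : ℝ :=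
  (2 * Δ * bil Q y v + Δ ^ 2 * quad Q v + Δ * quad Q (WithLp.toLp 2 (G *ᵥ ζ.ofLp)))
    / (1 + quad Q y)

section step
variable {n d : ℕ} {Q : Matrix (Fin n) (Fin n) ℝ}

theorem oddPart_neg (Δ : ℝ) (y v : Vec n) (G : Matrix (Fin n) (Fin d) ℝ) (ζ : Vec d) :
    oddPart Q Δ y v G (-ζ) = - oddPart Q Δ y v G ζ := by
  have : (WithLp.toLp 2 (G *ᵥ (-ζ).ofLp) : Vec n) = (-1 : ℝ) • WithLp.toLp 2 (G *ᵥ ζ.ofLp) := by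
    simp [Matrix.mulVec_neg]
  rw [oddPart, this, bil_smul_right, oddPart]
  ring

theorem evenPart_neg (Δ : ℝ) (y v : Vec n) (G : Matrix (Fin n) (Fin d) ℝ) (ζ : Vec d) :
    evenPart Q Δ y v G (-ζ) = evenPart Q Δ y v G ζ := by
  have : (WithLp.toLp 2 (G *ᵥ (-ζ).ofLp) : Vec n) = (-1 : ℝ) • WithLp.toLp 2 (G *ᵥ ζ.ofLp) := by
    simp [Matrix.mulVec_neg]
  rw [evenPart, this, quad_smul, evenPart]
  ring

theorem one_add_quad_step (hQ : Q.PosDef) {Δ : ℝ} (hΔ : 0 ≤ Δ) (y v : Vec n)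
    (G : Matrix (Fin n) (Fin d) ℝ) (ζ : Vec d) :
    1 + quad Q (y + Δ • v + WithLp.toLp 2 (G *ᵥ (√Δ • ζ).ofLp)) =
      (1 + quad Q y) * (1 + (evenPart Q Δ y v G ζ + oddPart Q Δ y v G ζ)) := by
  have h : (WithLp.toLp 2 (G *ᵥ (√Δ • ζ).ofLp) : Vec n) = √Δ • WithLp.toLp 2 (G *ᵥ ζ.ofLp) := by
    simp [Matrix.mulVec_smul]
  have hW : 1 + quad Q y ≠ 0 := by
    have := quad_nonneg hQ y
    positivity
  rw [h, quad_add hQ, quad_smul, bil_smul_right, quad_add hQ y, quad_smul, bil_smul_right,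
    Real.sq_sqrt hΔ, oddPart, evenPart]
  field_simp
  ring

variable {c Λ K₀ H Δ : ℝ}

/-- The powers of `1 + ‖y‖` from the coefficients cancel against those of `1 + yᵀQy`, so the bound
depends on `HΔ` and `ζ` only; the same holds for `evenPart`. The bound `K₀` on `HΔ` absorbs higher
powers. -/
theorem oddPart_sq_le (hc : 0 < c) (hcQ : ∀ x : Vec n, c * (1 + ‖x‖) ^ 2 ≤ 1 + quad Q x)
    (hΛ : ∀ x y : Vec n, |bil Q x y| ≤ Λ * (‖x‖ * ‖y‖)) (hH : 0 ≤ H) (hΔ : 0 ≤ Δ)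
    (hK : H * Δ ≤ K₀) {y v : Vec n} {G : Matrix (Fin n) (Fin d) ℝ} (hv : ‖v‖ ≤ H * (1 + ‖y‖))
    (hG : traceNorm G ^ 2 ≤ H * (1 + ‖y‖) ^ 2) (ζ : Vec d) :
    oddPart Q Δ y v G ζ ^ 2 ≤ 4 * Λ ^ 2 * (1 + K₀) ^ 2 / c ^ 2 * (H * Δ * ‖ζ‖ ^ 2) := by
  set w := 1 + ‖y‖ with hw
  have hw1 : 0 < w := by positivity
  set z : Vec n := WithLp.toLp 2 (G *ᵥ ζ.ofLp) with hz
  have hK0 : 0 ≤ K₀ := (mul_nonneg hH hΔ).trans hK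
  have hE : ‖y + Δ • v‖ ≤ w * (1 + K₀) := by
    calc ‖y + Δ • v‖ ≤ ‖y‖ + Δ * ‖v‖ := by
          refine (norm_add_le _ _).trans ?_
          rw [norm_smul, Real.norm_of_nonneg hΔ]
      _ ≤ w + Δ * (H * w) := by gcongr; linarith
      _ = w * (1 + H * Δ) := by ring
      _ ≤ w * (1 + K₀) := by gcongr
  have hzn : ‖z‖ ^ 2 ≤ H * w ^ 2 * ‖ζ‖ ^ 2 :=
    (norm_mulVec_sq_le G ζ).trans (by gcongr)
  have hb : bil Q (y + Δ • v) z ^ 2 ≤ Λ ^ 2 * (w * (1 + K₀)) ^ 2 * (H * w ^ 2 * ‖ζ‖ ^ 2) := by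
    calc bil Q (y + Δ • v) z ^ 2 = |bil Q (y + Δ • v) z| ^ 2 := (sq_abs _).symm
      _ ≤ (Λ * (‖y + Δ • v‖ * ‖z‖)) ^ 2 := by gcongr; exact hΛ _ _
      _ = Λ ^ 2 * ‖y + Δ • v‖ ^ 2 * ‖z‖ ^ 2 := by ring
      _ ≤ _ := by gcongr
  have hW : (c * w ^ 2) ^ 2 ≤ (1 + quad Q y) ^ 2 := by gcongr; exact hcQ y
  rw [oddPart, div_pow, ← hz]
  calc (2 * √Δ * bil Q (y + Δ • v) z) ^ 2 / (1 + quad Q y) ^ 2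
      = 4 * Δ * bil Q (y + Δ • v) z ^ 2 / (1 + quad Q y) ^ 2 := by
        rw [mul_pow, mul_pow, Real.sq_sqrt hΔ]; ring
    _ ≤ 4 * Δ * (Λ ^ 2 * (w * (1 + K₀)) ^ 2 * (H * w ^ 2 * ‖ζ‖ ^ 2)) / (c * w ^ 2) ^ 2 := by
        gcongr
    _ = _ := by field_simp

theorem abs_evenPart_le (hQ : Q.PosDef) (hc : 0 < c) (hΛ0 : 0 ≤ Λ)
    (hcQ : ∀ x : Vec n, c * (1 + ‖x‖) ^ 2 ≤ 1 + quad Q x)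
    (hΛ : ∀ x y : Vec n, |bil Q x y| ≤ Λ * (‖x‖ * ‖y‖)) (hH : 0 ≤ H) (hΔ : 0 ≤ Δ)
    (hK : H * Δ ≤ K₀) {y v : Vec n} {G : Matrix (Fin n) (Fin d) ℝ} (hv : ‖v‖ ≤ H * (1 + ‖y‖))
    (hG : traceNorm G ^ 2 ≤ H * (1 + ‖y‖) ^ 2) (ζ : Vec d) :
    |evenPart Q Δ y v G ζ| ≤ Λ * (2 + K₀) / c * (H * Δ * (1 + ‖ζ‖ ^ 2)) := by
  set w := 1 + ‖y‖ with hw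
  have hw1 : 0 < w := by positivity
  set z : Vec n := WithLp.toLp 2 (G *ᵥ ζ.ofLp) with hz
  have hK0 : 0 ≤ K₀ := (mul_nonneg hH hΔ).trans hK
  have hzn : ‖z‖ ^ 2 ≤ H * w ^ 2 * ‖ζ‖ ^ 2 :=
    (norm_mulVec_sq_le G ζ).trans (by gcongr)
  have h1 : |bil Q y v| ≤ Λ * (w * (H * w)) := by
    refine (hΛ _ _).trans ?_
    gcongr
    linarith
  have h2 : |quad Q v| ≤ Λ * (H * w * (H * w)) := by
    refine (hΛ _ _).trans ?_
    gcongr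
  have h3 : |quad Q z| ≤ Λ * (H * w ^ 2 * ‖ζ‖ ^ 2) := by
    refine (hΛ _ _).trans ?_
    rw [← sq]
    gcongr
  have hW0 : 0 < 1 + quad Q y := by
    have := quad_nonneg hQ y
    positivity
  rw [evenPart, abs_div, abs_of_pos hW0, ← hz]
  have hnum : |2 * Δ * bil Q y v + Δ ^ 2 * quad Q v + Δ * quad Q z| ≤
      2 * Δ * (Λ * (w * (H * w))) + Δ ^ 2 * (Λ * (H * w * (H * w)))
        + Δ * (Λ * (H * w ^ 2 * ‖ζ‖ ^ 2)) := by
    refine (abs_add_le _ _).trans (add_le_add ((abs_add_le _ _).trans (add_le_add ?_ ?_)) ?_)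
    · rw [abs_mul, abs_of_nonneg (by positivity : 0 ≤ 2 * Δ)]; gcongr
    · rw [abs_mul, abs_of_nonneg (by positivity : 0 ≤ Δ ^ 2)]; gcongr
    · rw [abs_mul, abs_of_nonneg hΔ]; gcongr
  have hnum2 : 2 * Δ * (Λ * (w * (H * w))) + Δ ^ 2 * (Λ * (H * w * (H * w)))
        + Δ * (Λ * (H * w ^ 2 * ‖ζ‖ ^ 2)) ≤ Λ * (2 + K₀) * (H * Δ * (1 + ‖ζ‖ ^ 2)) * w ^ 2 := by
    have e : 2 * Δ * (Λ * (w * (H * w))) + Δ ^ 2 * (Λ * (H * w * (H * w)))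
        + Δ * (Λ * (H * w ^ 2 * ‖ζ‖ ^ 2)) =
        Λ * w ^ 2 * (H * Δ) * (2 + H * Δ + ‖ζ‖ ^ 2) := by ring
    have e2 : Λ * (2 + K₀) * (H * Δ * (1 + ‖ζ‖ ^ 2)) * w ^ 2 =
        Λ * w ^ 2 * (H * Δ) * ((2 + K₀) * (1 + ‖ζ‖ ^ 2)) := by ring
    rw [e, e2]
    gcongr
    nlinarith [sq_nonneg ‖ζ‖]
  calc _ ≤ Λ * (2 + K₀) * (H * Δ * (1 + ‖ζ‖ ^ 2)) * w ^ 2 / (c * w ^ 2) := by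
        gcongr
        · exact hnum.trans hnum2
        · exact hcQ y
    _ = _ := by field_simp

theorem continuous_evenPart (Δ : ℝ) (y v : Vec n) (G : Matrix (Fin n) (Fin d) ℝ) :
    Continuous (evenPart Q Δ y v G) := by
  unfold evenPart quad
  fun_prop

theorem continuous_oddPart (Δ : ℝ) (y v : Vec n) (G : Matrix (Fin n) (Fin d) ℝ) :
    Continuous (oddPart Q Δ y v G) := by
  unfold oddPart bil
  fun_prop

theorem integrable_evenPart (Δ : ℝ) (y v : Vec n) (G : Matrix (Fin n) (Fin d) ℝ) :
    Integrable (evenPart Q Δ y v G) (stdGaussian (Vec d)) := by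
  unfold evenPart
  simp_rw [quad_mulVec]
  exact ((integrable_const _).add
    ((integrable_dotProduct_mulVec_stdGaussian _).const_mul _)).div_const _

theorem integral_evenPart (Δ : ℝ) (y v : Vec n) (G : Matrix (Fin n) (Fin d) ℝ) :
    ∫ ζ, evenPart Q Δ y v G ζ ∂stdGaussian (Vec d) =
      (2 * Δ * bil Q y v + Δ ^ 2 * quad Q v + Δ * (Gᵀ * Q * G).trace) / (1 + quad Q y) := by
  unfold evenPart
  simp_rw [quad_mulVec]
  rw [integral_div, integral_add (integrable_const _)
    ((integrable_dotProduct_mulVec_stdGaussian _).const_mul _), integral_const_mul,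
    integral_dotProduct_mulVec_stdGaussian]
  simp

theorem oddPart_sq (hΔ : 0 ≤ Δ) (y v : Vec n) (G : Matrix (Fin n) (Fin d) ℝ) (ζ : Vec d) :
    oddPart Q Δ y v G ζ ^ 2 = 4 * Δ / (1 + quad Q y) ^ 2 *
      inner ℝ (WithLp.toLp 2 ((y + Δ • v).ofLp ᵥ* (Q * G)) : Vec d) ζ ^ 2 := by
  rw [oddPart, div_pow, mul_pow, mul_pow, Real.sq_sqrt hΔ, bil_mulVec]
  ring

theorem integrable_oddPart_sq (hΔ : 0 ≤ Δ) (y v : Vec n) (G : Matrix (Fin n) (Fin d) ℝ) :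
    Integrable (fun ζ ↦ oddPart Q Δ y v G ζ ^ 2) (stdGaussian (Vec d)) := by
  simp_rw [oddPart_sq hΔ]
  exact (integrable_inner_sq_stdGaussian _).const_mul _

theorem integral_oddPart_sq (hΔ : 0 ≤ Δ) (y v : Vec n) (G : Matrix (Fin n) (Fin d) ℝ) :
    ∫ ζ, oddPart Q Δ y v G ζ ^ 2 ∂stdGaussian (Vec d) = 4 * Δ / (1 + quad Q y) ^ 2 *
      ‖(WithLp.toLp 2 ((y + Δ • v).ofLp ᵥ* (Q * G)) : Vec d)‖ ^ 2 := by
  simp_rw [oddPart_sq hΔ]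
  rw [integral_const_mul, integral_inner_sq_stdGaussian]

/-- Replacing `y + Δv` by `y` in the variance of the odd part costs `H²Δ`. The prefactor `Δ` of that
variance turns this into the admissible error `(HΔ)²`. -/
theorem abs_norm_vecMul_add_sq_sub_le (hΛ0 : 0 ≤ Λ)
    (hΛ : ∀ x y : Vec n, |bil Q x y| ≤ Λ * (‖x‖ * ‖y‖)) (hH : 0 ≤ H) (hΔ : 0 ≤ Δ)
    (hK : H * Δ ≤ K₀) {y v : Vec n} {G : Matrix (Fin n) (Fin d) ℝ} (hv : ‖v‖ ≤ H * (1 + ‖y‖))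
    (hG : traceNorm G ^ 2 ≤ H * (1 + ‖y‖) ^ 2) :
    |‖(WithLp.toLp 2 ((y + Δ • v).ofLp ᵥ* (Q * G)) : Vec d)‖ ^ 2
        - ‖(WithLp.toLp 2 (y.ofLp ᵥ* (Q * G)) : Vec d)‖ ^ 2|
      ≤ Λ ^ 2 * (2 + K₀) * (H ^ 2 * Δ) * (1 + ‖y‖) ^ 4 := by
  set w := 1 + ‖y‖ with hw
  have hw1 : 0 < w := by positivity
  have hK0 : 0 ≤ K₀ := (mul_nonneg hH hΔ).trans hK
  have hadd : (WithLp.toLp 2 ((y + Δ • v).ofLp ᵥ* (Q * G)) : Vec d) =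
      WithLp.toLp 2 (y.ofLp ᵥ* (Q * G)) + Δ • WithLp.toLp 2 (v.ofLp ᵥ* (Q * G)) := by
    simp [Matrix.add_vecMul, Matrix.smul_vecMul]
  have hy := norm_vecMul_le hΛ hΛ0 G y
  have hv' := norm_vecMul_le hΛ hΛ0 G v
  set β₁ : Vec d := WithLp.toLp 2 (y.ofLp ᵥ* (Q * G))
  set β₂ : Vec d := WithLp.toLp 2 (v.ofLp ᵥ* (Q * G))
  have hT : 0 ≤ traceNorm G := Real.sqrt_nonneg _
  rw [hadd, norm_add_sq_real, norm_smul, Real.norm_of_nonneg hΔ, real_inner_smul_right]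
  have e : ‖β₁‖ ^ 2 + 2 * (Δ * inner ℝ β₁ β₂) + (Δ * ‖β₂‖) ^ 2 - ‖β₁‖ ^ 2 =
      2 * Δ * inner ℝ β₁ β₂ + Δ ^ 2 * ‖β₂‖ ^ 2 := by ring
  rw [e]
  have hi : |inner ℝ β₁ β₂| ≤ Λ ^ 2 * H ^ 2 * w ^ 4 := by
    calc |inner ℝ β₁ β₂| ≤ ‖β₁‖ * ‖β₂‖ := abs_real_inner_le_norm _ _
      _ ≤ (Λ * ‖y‖ * traceNorm G) * (Λ * ‖v‖ * traceNorm G) := by gcongr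
      _ = Λ ^ 2 * ‖y‖ * ‖v‖ * traceNorm G ^ 2 := by ring
      _ ≤ Λ ^ 2 * w * (H * w) * (H * w ^ 2) := by gcongr; linarith
      _ = _ := by ring
  have h2 : ‖β₂‖ ^ 2 ≤ Λ ^ 2 * H ^ 3 * w ^ 4 := by
    calc ‖β₂‖ ^ 2 ≤ (Λ * ‖v‖ * traceNorm G) ^ 2 := by gcongr
      _ = Λ ^ 2 * ‖v‖ ^ 2 * traceNorm G ^ 2 := by ring
      _ ≤ Λ ^ 2 * (H * w) ^ 2 * (H * w ^ 2) := by gcongr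
      _ = _ := by ring
  calc |2 * Δ * inner ℝ β₁ β₂ + Δ ^ 2 * ‖β₂‖ ^ 2|
      ≤ 2 * Δ * |inner ℝ β₁ β₂| + Δ ^ 2 * ‖β₂‖ ^ 2 := by
        refine (abs_add_le _ _).trans (le_of_eq ?_)
        rw [abs_mul, abs_of_nonneg (by positivity : 0 ≤ 2 * Δ),
          abs_of_nonneg (by positivity : 0 ≤ Δ ^ 2 * ‖β₂‖ ^ 2)]
    _ ≤ 2 * Δ * (Λ ^ 2 * H ^ 2 * w ^ 4) + Δ ^ 2 * (Λ ^ 2 * H ^ 3 * w ^ 4) := by gcongr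
    _ = Λ ^ 2 * (2 + H * Δ) * (H ^ 2 * Δ) * w ^ 4 := by ring
    _ ≤ _ := by gcongr

end step

/-- The generator of the diffusion with coefficients `v` and `G` at `y`, applied to
`(1 + xᵀQx)^a` and divided by `a (1 + yᵀQy)^a`. -/
noncomputable def drift {n d : ℕ} (Q : Matrix (Fin n) (Fin n) ℝ) (a : ℝ) (y v : Vec n)
    (G : Matrix (Fin n) (Fin d) ℝ) : ℝ :=
  ((1 + quad Q y) * (2 * bil Q y v + (Gᵀ * Q * G).trace)
    - (2 - 2 * a) * ‖(WithLp.toLp 2 (y.ofLp ᵥ* (Q * G)) : Vec d)‖ ^ 2) / (1 + quad Q y) ^ 2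

/-- The Gaussian mean of the second-order expansion is the generator term, plus `Δ² vᵀQv` and the
effect of moving `y + Δv` back to `y`; both are `O((HΔ)²)`. -/
theorem exists_integral_expansion_le {n d : ℕ} {Q : Matrix (Fin n) (Fin n) ℝ} (hQ : Q.PosDef)
    {a : ℝ} (ha : 0 ≤ a) (K₀ : ℝ) : ∃ C : ℝ, 0 ≤ C ∧
    ∀ (H Δ : ℝ) (y v : Vec n) (G : Matrix (Fin n) (Fin d) ℝ), 0 ≤ H → 0 ≤ Δ → H * Δ ≤ K₀ →
      ‖v‖ ≤ H * (1 + ‖y‖) → traceNorm G ^ 2 ≤ H * (1 + ‖y‖) ^ 2 →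
      1 + a * ∫ ζ, evenPart Q Δ y v G ζ ∂stdGaussian (Vec d)
        + a * (a - 1) / 2 * ∫ ζ, oddPart Q Δ y v G ζ ^ 2 ∂stdGaussian (Vec d)
      ≤ 1 + a * Δ * drift Q a y v G + C * (H * Δ) ^ 2 := by
  obtain ⟨c, hc, hcQ⟩ := exists_le_one_add_quad hQ
  obtain ⟨Λ, hΛ0, hΛ⟩ := exists_abs_bil_le Q
  refine ⟨a * (Λ / c) + |a * (a - 1) / 2| * (4 * (Λ ^ 2 * (2 + |K₀|)) / c ^ 2), by positivity,
    fun H Δ y v G hH hΔ hK hv hG ↦ ?_⟩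
  have hK' : H * Δ ≤ |K₀| := hK.trans (le_abs_self _)
  have hdiff := abs_norm_vecMul_add_sq_sub_le (d := d) hΛ0 hΛ hH hΔ hK' hv hG
  rw [integral_evenPart, integral_oddPart_sq hΔ, drift]
  set w := 1 + ‖y‖ with hw
  have hw1 : 0 < w := by positivity
  set N₁ := ‖(WithLp.toLp 2 ((y + Δ • v).ofLp ᵥ* (Q * G)) : Vec d)‖ ^ 2
  set N₀ := ‖(WithLp.toLp 2 (y.ofLp ᵥ* (Q * G)) : Vec d)‖ ^ 2
  have hWc := hcQ y
  have hW0 : 0 < 1 + quad Q y := by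
    have := quad_nonneg hQ y
    positivity
  set W := 1 + quad Q y
  have h1 : Δ ^ 2 * quad Q v / W ≤ Λ / c * (H * Δ) ^ 2 := by
    have : quad Q v ≤ Λ * (H * w * (H * w)) := by
      refine (le_abs_self _).trans ((hΛ _ _).trans ?_)
      gcongr
    calc Δ ^ 2 * quad Q v / W ≤ Δ ^ 2 * (Λ * (H * w * (H * w))) / (c * w ^ 2) := by
          gcongr
      _ = _ := by field_simp
  have h2 : a * (a - 1) / 2 * (4 * Δ / W ^ 2 * (N₁ - N₀)) ≤
      |a * (a - 1) / 2| * (4 * (Λ ^ 2 * (2 + |K₀|)) / c ^ 2) * (H * Δ) ^ 2 := by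
    refine (le_abs_self _).trans ?_
    rw [abs_mul, mul_assoc]
    gcongr
    rw [abs_mul, abs_of_nonneg (by positivity : 0 ≤ 4 * Δ / W ^ 2)]
    calc 4 * Δ / W ^ 2 * |N₁ - N₀|
        ≤ 4 * Δ / (c * w ^ 2) ^ 2 * (Λ ^ 2 * (2 + |K₀|) * (H ^ 2 * Δ) * w ^ 4) := by
          gcongr
      _ = _ := by field_simp
  have e : 1 + a * ((2 * Δ * bil Q y v + Δ ^ 2 * quad Q v + Δ * (Gᵀ * Q * G).trace) / W)
      + a * (a - 1) / 2 * (4 * Δ / W ^ 2 * N₁) =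
      1 + a * Δ * ((W * (2 * bil Q y v + (Gᵀ * Q * G).trace) - (2 - 2 * a) * N₀) / W ^ 2)
        + a * (Δ ^ 2 * quad Q v / W) + a * (a - 1) / 2 * (4 * Δ / W ^ 2 * (N₁ - N₀)) := by
    field_simp
    ring
  rw [e]
  have h3 := mul_le_mul_of_nonneg_left h1 ha
  linarith

/-- The symmetry of the Gaussian law allows `F(ζ)` to be replaced by the mean of `F(ζ)` and `F(-ζ)`,
to which `exists_symm_rpow_le` applies pointwise. The constant depends on `K₀` but not on `H`, `Δ`
or the point. -/
theorem exists_lintegral_step_le {n d : ℕ} {Q : Matrix (Fin n) (Fin n) ℝ} (hQ : Q.PosDef)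
    {a : ℝ} (ha : 0 ≤ a) (K₀ : ℝ) : ∃ C : ℝ, 0 ≤ C ∧
    ∀ (H Δ : ℝ) (y v : Vec n) (G : Matrix (Fin n) (Fin d) ℝ), 0 ≤ H → 0 ≤ Δ → H * Δ ≤ K₀ →
      ‖v‖ ≤ H * (1 + ‖y‖) → traceNorm G ^ 2 ≤ H * (1 + ‖y‖) ^ 2 →
      ∫⁻ ζ, ENNReal.ofReal ((1 + quad Q (y + Δ • v + WithLp.toLp 2 (G *ᵥ (√Δ • ζ).ofLp))) ^ a)
        ∂stdGaussian (Vec d)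
      ≤ ENNReal.ofReal ((1 + quad Q y) ^ a *
          (1 + a * Δ * drift Q a y v G + C * (H * Δ) ^ 2)) := by
  obtain ⟨c, hc, hcQ⟩ := exists_le_one_add_quad hQ
  obtain ⟨Λ, hΛ0, hΛ⟩ := exists_abs_bil_le Q
  obtain ⟨C₁, hC₁, hexp⟩ := exists_integral_expansion_le (d := d) hQ ha K₀
  obtain ⟨C₂, N, hC₂, hN, hsymm⟩ := exists_symm_rpow_le ha
  -- A common factor for both parts: `L²` and `|R|` are at most `t = A · HΔ · (1 + ‖ζ‖²)`. In `D`,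
  -- all but two of the `2N` factors `HΔ` of `t^(2N)` are bounded by `|K₀|`.
  set A := 4 * Λ ^ 2 * (1 + |K₀|) ^ 2 / c ^ 2 + Λ * (2 + |K₀|) / c with hA
  have hA0 : 0 ≤ A := by positivity
  set D := C₂ * (A ^ 2 + A ^ (2 * N) * |K₀| ^ (2 * N - 2)) with hD
  have hD0 : 0 ≤ D := by positivity
  set M := ∫ ζ : Vec d, (1 + ‖ζ‖ ^ 2) ^ (2 * N) ∂stdGaussian (Vec d) with hM
  have hM0 : 0 ≤ M := integral_nonneg fun ζ ↦ by positivity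
  refine ⟨C₁ + D * M, by positivity, fun H Δ y v G hH hΔ hK hv hG ↦ ?_⟩
  have hK' : H * Δ ≤ |K₀| := hK.trans (le_abs_self _)
  have hHΔ : 0 ≤ H * Δ := mul_nonneg hH hΔ
  have hW0 : 0 < 1 + quad Q y := by
    have := quad_nonneg hQ y
    positivity
  set L := oddPart Q Δ y v G with hL
  set R := evenPart Q Δ y v G with hR
  have hpos : ∀ ζ : Vec d, 0 < 1 + (R ζ + L ζ) := by
    intro ζ
    have h1 := one_add_quad_step hQ hΔ y v G ζ
    have h2 := quad_nonneg hQ (y + Δ • v + WithLp.toLp 2 (G *ᵥ (√Δ • ζ).ofLp))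
    have h3 : 0 < (1 + quad Q y) * (1 + (R ζ + L ζ)) := by rw [← h1]; positivity
    exact pos_of_mul_pos_right h3 hW0.le
  have hneg : ∀ ζ : Vec d, R (-ζ) + L (-ζ) = R ζ - L ζ := by
    intro ζ
    rw [hR, hL, evenPart_neg, oddPart_neg]
    ring
  have hpt : ∀ ζ : Vec d, ((1 + (R ζ + L ζ)) ^ a + (1 + (R ζ - L ζ)) ^ a) / 2 ≤
      1 + a * R ζ + a * (a - 1) / 2 * L ζ ^ 2 + D * (H * Δ) ^ 2 * (1 + ‖ζ‖ ^ 2) ^ (2 * N) := by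
    intro ζ
    set s := 1 + ‖ζ‖ ^ 2 with hs
    have hs1 : 1 ≤ s := by rw [hs]; nlinarith [sq_nonneg ‖ζ‖]
    have hs0 : 0 ≤ s := by linarith
    have b1 : L ζ ^ 2 ≤ A * (H * Δ * s) := by
      refine (oddPart_sq_le hc hcQ hΛ hH hΔ hK' hv hG ζ).trans ?_
      have : 0 ≤ Λ * (2 + |K₀|) / c := by positivity
      gcongr <;> linarith
    have b2 : |R ζ| ≤ A * (H * Δ * s) := by
      refine (abs_evenPart_le hQ hc hΛ0 hcQ hΛ hH hΔ hK' hv hG ζ).trans ?_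
      have : 0 ≤ 4 * Λ ^ 2 * (1 + |K₀|) ^ 2 / c ^ 2 := by positivity
      gcongr
      linarith
    refine (hsymm _ _ _ b1 b2 (hpos ζ) (by rw [← hneg]; exact hpos (-ζ))).trans ?_
    have b3 : (A * (H * Δ * s)) ^ 2 ≤ A ^ 2 * (H * Δ) ^ 2 * s ^ (2 * N) := by
      calc (A * (H * Δ * s)) ^ 2 = A ^ 2 * (H * Δ) ^ 2 * s ^ 2 := by ring
        _ ≤ _ := by
          have := pow_le_pow_right₀ hs1 (by omega : 2 ≤ 2 * N)
          gcongr
    have b4 : (A * (H * Δ * s)) ^ (2 * N) ≤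
        A ^ (2 * N) * |K₀| ^ (2 * N - 2) * (H * Δ) ^ 2 * s ^ (2 * N) := by
      have e1 : (H * Δ) ^ (2 * N) = (H * Δ) ^ (2 * N - 2) * (H * Δ) ^ 2 := by
        rw [← pow_add]
        congr 1
        omega
      calc (A * (H * Δ * s)) ^ (2 * N)
          = A ^ (2 * N) * (H * Δ) ^ (2 * N - 2) * (H * Δ) ^ 2 * s ^ (2 * N) := by
            rw [mul_pow, mul_pow, e1]; ring
        _ ≤ _ := by gcongr
    have b5 : C₂ * ((A * (H * Δ * s)) ^ 2 + (A * (H * Δ * s)) ^ (2 * N)) ≤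
        D * (H * Δ) ^ 2 * s ^ (2 * N) := by
      calc _ ≤ C₂ * (A ^ 2 * (H * Δ) ^ 2 * s ^ (2 * N) +
            A ^ (2 * N) * |K₀| ^ (2 * N - 2) * (H * Δ) ^ 2 * s ^ (2 * N)) := by gcongr
        _ = _ := by rw [hD]; ring
    linarith
  have i1 : Integrable (fun _ : Vec d ↦ (1 : ℝ)) (stdGaussian (Vec d)) := integrable_const _
  have i2 : Integrable (fun ζ ↦ a * R ζ) (stdGaussian (Vec d)) :=
    (integrable_evenPart Δ y v G).const_mul a
  have i3 : Integrable (fun ζ ↦ a * (a - 1) / 2 * L ζ ^ 2) (stdGaussian (Vec d)) :=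
    (integrable_oddPart_sq hΔ y v G).const_mul _
  have i4 : Integrable (fun ζ ↦ D * (H * Δ) ^ 2 * (1 + ‖ζ‖ ^ 2) ^ (2 * N))
      (stdGaussian (Vec d)) := (integrable_one_add_norm_sq_pow_stdGaussian d _).const_mul _
  have i12 : Integrable (fun ζ ↦ 1 + a * R ζ) (stdGaussian (Vec d)) := i1.add i2
  have i123 : Integrable (fun ζ ↦ 1 + a * R ζ + a * (a - 1) / 2 * L ζ ^ 2)
      (stdGaussian (Vec d)) := i12.add i3
  have hint : Integrable (fun ζ : Vec d ↦ 1 + a * R ζ + a * (a - 1) / 2 * L ζ ^ 2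
      + D * (H * Δ) ^ 2 * (1 + ‖ζ‖ ^ 2) ^ (2 * N)) (stdGaussian (Vec d)) := i123.add i4
  have hintv : ∫ ζ : Vec d, 1 + a * R ζ + a * (a - 1) / 2 * L ζ ^ 2
      + D * (H * Δ) ^ 2 * (1 + ‖ζ‖ ^ 2) ^ (2 * N) ∂stdGaussian (Vec d) =
      1 + a * ∫ ζ, R ζ ∂stdGaussian (Vec d)
        + a * (a - 1) / 2 * ∫ ζ, L ζ ^ 2 ∂stdGaussian (Vec d) + D * (H * Δ) ^ 2 * M := by
    rw [integral_add i123 i4, integral_add i12 i3, integral_add i1 i2,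
      integral_const_mul, integral_const_mul, integral_const_mul, ← hM]
    simp
  have hLc : Continuous L := continuous_oddPart Δ y v G
  have hRc : Continuous R := continuous_evenPart Δ y v G
  set F : Vec d → ENNReal := fun ζ ↦ ENNReal.ofReal ((1 + (R ζ + L ζ)) ^ a) with hF
  have hFm : Measurable F := by
    refine ENNReal.measurable_ofReal.comp ?_
    exact (measurable_const.add (hRc.measurable.add hLc.measurable)).pow_const a
  have hFneg : ∫⁻ ζ, F (-ζ) ∂stdGaussian (Vec d) = ∫⁻ ζ, F ζ ∂stdGaussian (Vec d) := by
    conv_rhs => rw [← map_neg_stdGaussian d]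
    rw [lintegral_map hFm measurable_neg]
  have hFle : ∫⁻ ζ, F ζ ∂stdGaussian (Vec d) ≤ ENNReal.ofReal
      (1 + a * Δ * drift Q a y v G + (C₁ + D * M) * (H * Δ) ^ 2) := by
    calc ∫⁻ ζ, F ζ ∂stdGaussian (Vec d)
        = ENNReal.ofReal (1 / 2) * (∫⁻ ζ, F ζ ∂stdGaussian (Vec d)
            + ∫⁻ ζ, F (-ζ) ∂stdGaussian (Vec d)) := by
          rw [hFneg, ← two_mul, ← mul_assoc]
          have : ENNReal.ofReal (1 / 2) * 2 = 1 := by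
            rw [← ENNReal.ofReal_ofNat, ← ENNReal.ofReal_mul (by norm_num)]
            norm_num
          rw [this, one_mul]
      _ = ∫⁻ ζ, ENNReal.ofReal (((1 + (R ζ + L ζ)) ^ a + (1 + (R ζ - L ζ)) ^ a) / 2)
            ∂stdGaussian (Vec d) := by
          have hm : Measurable fun ζ ↦ F ζ + F (-ζ) := hFm.add (hFm.comp measurable_neg)
          rw [← lintegral_add_left hFm, ← lintegral_const_mul _ hm]
          refine lintegral_congr fun ζ ↦ ?_
          have p1 := hpos ζ
          have p2 : 0 < 1 + (R ζ - L ζ) := by rw [← hneg]; exact hpos (-ζ)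
          simp only [hF, hneg]
          rw [← ENNReal.ofReal_add (by positivity) (by positivity),
            ← ENNReal.ofReal_mul (by norm_num)]
          congr 1
          ring
      _ ≤ ∫⁻ ζ, ENNReal.ofReal (1 + a * R ζ + a * (a - 1) / 2 * L ζ ^ 2
            + D * (H * Δ) ^ 2 * (1 + ‖ζ‖ ^ 2) ^ (2 * N)) ∂stdGaussian (Vec d) :=
          lintegral_mono fun ζ ↦ ENNReal.ofReal_le_ofReal (hpt ζ)
      _ = ENNReal.ofReal (1 + a * ∫ ζ, R ζ ∂stdGaussian (Vec d)
            + a * (a - 1) / 2 * ∫ ζ, L ζ ^ 2 ∂stdGaussian (Vec d) + D * (H * Δ) ^ 2 * M) := by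
          rw [← hintv, ofReal_integral_eq_lintegral_ofReal hint]
          refine ae_of_all _ fun ζ ↦ ?_
          have p1 := hpos ζ
          have p2 : 0 < 1 + (R ζ - L ζ) := by rw [← hneg]; exact hpos (-ζ)
          exact le_trans (by positivity) (hpt ζ)
      _ ≤ _ := by
          refine ENNReal.ofReal_le_ofReal ?_
          have := hexp H Δ y v G hH hΔ hK hv hG
          rw [← hL, ← hR] at this
          linarith
  calc _ = ∫⁻ ζ, ENNReal.ofReal ((1 + quad Q y) ^ a) * F ζ ∂stdGaussian (Vec d) := by
        refine lintegral_congr fun ζ ↦ ?_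
        rw [one_add_quad_step hQ hΔ, Real.mul_rpow hW0.le (hpos ζ).le,
          ENNReal.ofReal_mul (by positivity)]
    _ = ENNReal.ofReal ((1 + quad Q y) ^ a) * ∫⁻ ζ, F ζ ∂stdGaussian (Vec d) :=
        lintegral_const_mul _ hFm
    _ ≤ _ := by
        rw [ENNReal.ofReal_mul (by positivity)]
        gcongr

/-! ### Continuity of the coefficients -/

theorem continuous_of_locallyLip {n : ℕ} {E : Type*} [SeminormedAddCommGroup E] {F : Vec n → E}
    (h : ∀ N > (0 : ℝ), ∃ C : ℝ, ∀ x y : Vec n, ‖x‖ ≤ N → ‖y‖ ≤ N → ‖F x - F y‖ ≤ C * ‖x - y‖) :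
    Continuous F := by
  rw [continuous_iff_continuousAt]
  intro x
  obtain ⟨C, hC⟩ := h (‖x‖ + 1) (by positivity)
  have h1 : ∀ᶠ y in 𝓝 x, ‖F y - F x‖ ≤ C * ‖y - x‖ := by
    filter_upwards [Metric.ball_mem_nhds x one_pos] with y hy
    refine hC y x ?_ (by linarith)
    have h2 : ‖y - x‖ < 1 := by rwa [mem_ball_iff_norm] at hy
    have := norm_le_norm_add_norm_sub x y
    rw [norm_sub_rev] at this
    linarith
  have h2 : Tendsto (fun y ↦ C * ‖y - x‖) (𝓝 x) (𝓝 0) := by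
    have : Continuous fun y ↦ C * ‖y - x‖ := by fun_prop
    simpa using this.tendsto x
  rw [ContinuousAt, tendsto_iff_norm_sub_tendsto_zero]
  exact squeeze_zero' (Eventually.of_forall fun _ ↦ norm_nonneg _) h1 h2

theorem abs_le_traceNorm {n d : ℕ} (A : Matrix (Fin n) (Fin d) ℝ) (i : Fin n) (j : Fin d) :
    |A i j| ≤ traceNorm A := by
  refine abs_le_of_sq_le_sq ?_ (Real.sqrt_nonneg _)
  rw [traceNorm_sq]
  calc A i j ^ 2 ≤ ∑ j, A i j ^ 2 :=
        Finset.single_le_sum (f := fun j ↦ A i j ^ 2) (fun _ _ ↦ sq_nonneg _) (Finset.mem_univ j)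
    _ ≤ _ := Finset.single_le_sum (f := fun i ↦ ∑ j, A i j ^ 2)
        (fun _ _ ↦ Finset.sum_nonneg fun _ _ ↦ sq_nonneg _) (Finset.mem_univ i)

section coefficients
variable {n d m : ℕ} {f : Vec n → Fin m → Vec n} {g : Vec n → Fin m → Matrix (Fin n) (Fin d) ℝ}

theorem LocallyLip.continuous_drift (hfg : LocallyLip f g) (i : Fin m) :
    Continuous fun x ↦ f x i :=
  continuous_of_locallyLip fun N hN ↦ by
    obtain ⟨C, -, hC⟩ := hfg N hN
    exact ⟨C, fun x y hx hy ↦ (hC x y hx hy i).1⟩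

theorem LocallyLip.continuous_diffusion (hfg : LocallyLip f g) (i : Fin m) :
    Continuous fun x ↦ g x i := by
  refine continuous_matrix fun k l ↦ continuous_of_locallyLip fun N hN ↦ ?_
  obtain ⟨C, -, hC⟩ := hfg N hN
  exact ⟨C, fun x y hx hy ↦ (abs_le_traceNorm (g x i - g y i) k l).trans (hC x y hx hy i).2⟩

/-! ### The growth condition bounds the drift of `(1 + xᵀQx)^(p/2)` -/

/-- Since `p ≤ pbar`, the subtracted term of the drift is at least that of the growth condition. The
denominators `(1 + q)²` and `q²` differ, but for large `q` this costs at most `ε/2`. -/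
theorem drift_le_of_growthCondition {Q : Matrix (Fin n) (Fin n) ℝ} (hQ : Q.PosDef)
    {pbar p : ℝ} (hp : p ≤ pbar) {i : Fin m} {α : ℝ} (hg : GrowthCondition f g Q pbar i α)
    {ε : ℝ} (hε : 0 < ε) :
    ∃ M : ℝ, ∀ y : Vec n, M ≤ ‖y‖ → drift Q (p / 2) y (f y i) (g y i) ≤ α + ε := by
  set b := α + ε / 2 with hb
  have hlt : (α : EReal) < (b : EReal) := EReal.coe_lt_coe_iff.mpr (by linarith)
  have hev := eventually_lt_of_limsup_lt (lt_of_le_of_lt hg hlt)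
  obtain ⟨M₁, -, hM₁⟩ := hasBasis_cobounded_norm.eventually_iff.mp hev
  obtain ⟨c, hc, hcQ⟩ := exists_le_quad hQ
  obtain ⟨c', hc', hcQ'⟩ := exists_le_one_add_quad hQ
  -- Beyond the last radius `4|b| ≤ ε(1 + q)`, so `|b| ((1 + q)² - q²) ≤ (ε/2)(1 + q)²`. The radius
  -- `1` keeps `q` positive.
  refine ⟨max (max M₁ 1) (4 * |b| / (ε * c')), fun y hy ↦ ?_⟩
  have hy1 : M₁ ≤ ‖y‖ := (le_max_left _ _).trans ((le_max_left _ _).trans hy)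
  have hy2 : 1 ≤ ‖y‖ := (le_max_right _ _).trans ((le_max_left _ _).trans hy)
  have hy3 : 4 * |b| / (ε * c') ≤ ‖y‖ := (le_max_right _ _).trans hy
  have h1 := hM₁ hy1
  rw [EReal.coe_lt_coe_iff] at h1
  have hq : 0 < quad Q y := lt_of_lt_of_le (by positivity) (hcQ y)
  rw [div_lt_iff₀ (by positivity)] at h1
  set q := quad Q y with hqdef
  set N₀ := ‖(WithLp.toLp 2 (y.ofLp ᵥ* (Q * g y i)) : Vec d)‖ ^ 2 with hN
  have hN0 : 0 ≤ N₀ := by positivity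
  have hbq : 4 * |b| ≤ ε * (1 + q) := by
    have h2 := hcQ' y
    rw [div_le_iff₀ (by positivity)] at hy3
    have h3 : c' * ‖y‖ ≤ 1 + q := by nlinarith [norm_nonneg y]
    nlinarith
  have hnum : (1 + q) * (2 * bil Q y (f y i) + ((g y i)ᵀ * Q * g y i).trace)
      - (2 - 2 * (p / 2)) * N₀ ≤ b * q ^ 2 := by
    have e : psi f g Q y i = 2 * bil Q y (f y i) + ((g y i)ᵀ * Q * g y i).trace := rfl
    rw [e] at h1
    nlinarith
  rw [drift, div_le_iff₀ (by positivity)]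
  refine hnum.trans ?_
  have h4 := neg_abs_le b
  have h5 : α + ε = b + ε / 2 := by rw [hb]; ring
  rw [h5]
  nlinarith

/-- Outside a ball the growth condition applies. Inside, continuity bounds the excess by a constant,
and summing over the finitely many states makes it uniform. -/
theorem exists_mul_drift_le (hfg : LocallyLip f g) {Q : Matrix (Fin n) (Fin n) ℝ} (hQ : Q.PosDef)
    {pbar p : ℝ} (hp : p ≤ pbar) {α : Fin m → ℝ}
    (hg : ∀ i, GrowthCondition f g Q pbar i (α i)) {ε : ℝ} (hε : 0 < ε) :
    ∃ C : ℝ, 0 ≤ C ∧ ∀ (i : Fin m) (y : Vec n),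
      (1 + quad Q y) ^ (p / 2) * drift Q (p / 2) y (f y i) (g y i) ≤
        (1 + quad Q y) ^ (p / 2) * (α i + ε) + C := by
  have key : ∀ i, ∃ C : ℝ, 0 ≤ C ∧ ∀ y : Vec n,
      (1 + quad Q y) ^ (p / 2) * drift Q (p / 2) y (f y i) (g y i) ≤
        (1 + quad Q y) ^ (p / 2) * (α i + ε) + C := by
    intro i
    obtain ⟨M, hM⟩ := drift_le_of_growthCondition hQ hp (hg i) hε
    have hpos : ∀ y : Vec n, 0 < 1 + quad Q y := fun y ↦ by
      have := quad_nonneg hQ y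
      positivity
    have hcf := hfg.continuous_drift i
    have hcg := hfg.continuous_diffusion i
    have hcq := continuous_quad (Q := Q)
    have hcont : Continuous fun y : Vec n ↦ (1 + quad Q y) ^ (p / 2) *
        (drift Q (p / 2) y (f y i) (g y i) - (α i + ε)) := by
      refine Continuous.mul ?_ (Continuous.sub ?_ continuous_const)
      · exact (continuous_const.add hcq).rpow_const fun y ↦ Or.inl (hpos y).ne'
      · unfold drift bil
        refine Continuous.div ?_ (by fun_prop) fun y ↦ (pow_pos (hpos y) 2).ne'
        fun_prop
    obtain ⟨C, hC⟩ := (isCompact_closedBall (0 : Vec n) M).bddAbove_image hcont.continuousOn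
    refine ⟨max C 0, le_max_right _ _, fun y ↦ ?_⟩
    have hV : 0 < (1 + quad Q y) ^ (p / 2) := Real.rpow_pos_of_pos (hpos y) _
    rcases le_total M ‖y‖ with h | h
    · have := mul_le_mul_of_nonneg_left (hM y h) hV.le
      linarith [le_max_right C 0]
    · have := hC ⟨y, by simpa using h, rfl⟩
      simp only at this
      linarith [le_max_left C 0]
  choose C hC0 hC using key
  refine ⟨∑ i, C i, Finset.sum_nonneg fun i _ ↦ hC0 i, fun i y ↦ (hC i y).trans ?_⟩
  gcongr
  exact Finset.single_le_sum (f := C) (fun i _ ↦ hC0 i) (Finset.mem_univ i)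

/-! ### The truncation -/

theorem measurable_truncate (ψ : ℝ → ℝ) (v : ℝ) : Measurable (truncate (n := n) ψ v) := by
  unfold truncate
  split_ifs
  · exact measurable_id
  · exact (measurable_norm.min measurable_const).smul
      (measurable_norm.inv.smul measurable_id)

/-- Ensures that `Function.invFunOn` returns a true preimage rather than its default value. -/
theorem mem_image_of_growthFunction {ψ : ℝ → ℝ} {v : ℝ} (hc : ContinuousOn ψ (Set.Ici 1))
    (ht : Tendsto ψ atTop atTop) (hv : ψ 1 ≤ v) : v ∈ ψ '' Set.Ici 1 := by
  obtain ⟨b, hb, hb1⟩ := ((ht.eventually_ge_atTop v).and (eventually_ge_atTop 1)).exists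
  obtain ⟨u, hu, huv⟩ := intermediate_value_Icc hb1 (hc.mono Set.Icc_subset_Ici_self) ⟨hv, hb⟩
  exact ⟨u, hu.1, huv⟩

/-- What truncation achieves: linear growth with constant `v = h(Δ)`. The radius `u` with `ψ u ≤ v`
is `ψ⁻¹(v)`, or any `u ≥ ‖y‖` when `ψ` is constant. -/
theorem growth_truncate {i : Fin m} {ψ : ℝ → ℝ} (hψ : IsGrowthFunction f g i ψ) {v : ℝ}
    (hv : ψ 1 ≤ v) (x : Vec n) :
    ‖f (truncate ψ v x) i‖ ≤ v * (1 + ‖truncate ψ v x‖) ∧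
      traceNorm (g (truncate ψ v x) i) ^ 2 ≤ v * (1 + ‖truncate ψ v x‖) ^ 2 := by
  set y := truncate ψ v x with hy
  have h : ∃ u, 1 ≤ u ∧ ‖y‖ ≤ u ∧ ψ u ≤ v := by
    by_cases hconst : IsConstFrom1 ψ
    · exact ⟨max ‖y‖ 1, le_max_right _ _, le_max_left _ _,
        (hconst _ (le_max_right _ _)).trans_le hv⟩
    · obtain ⟨-, hc, ht⟩ := hψ.2.resolve_right hconst
      have hmem := mem_image_of_growthFunction hc ht hv
      have h1 : 1 ≤ Function.invFunOn ψ (Set.Ici 1) v := Function.invFunOn_mem hmem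
      refine ⟨_, h1, ?_, (Function.invFunOn_eq hmem).le⟩
      rw [hy, truncate, if_neg hconst, norm_smul, norm_smul, norm_inv, norm_norm]
      have h2 : ‖x‖⁻¹ * ‖x‖ ≤ 1 := inv_mul_le_one
      have h3 : 0 ≤ min ‖x‖ (Function.invFunOn ψ (Set.Ici 1) v) :=
        le_min (norm_nonneg _) (by linarith)
      rw [Real.norm_of_nonneg h3]
      exact (mul_le_of_le_one_right h3 h2).trans (min_le_right _ _)
  obtain ⟨u, hu1, hyu, huv⟩ := h
  have h4 := (hψ.1 u hu1 y hyu).trans huv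
  have hw : 0 < 1 + ‖y‖ := by positivity
  exact ⟨(div_le_iff₀ hw).mp ((le_max_left _ _).trans h4),
    (div_le_iff₀ (by positivity)).mp ((le_max_right _ _).trans h4)⟩

theorem quad_truncate_le {Q : Matrix (Fin n) (Fin n) ℝ} (hQ : Q.PosDef) {i : Fin m} {ψ : ℝ → ℝ}
    (hψ : IsGrowthFunction f g i ψ) {v : ℝ} (hv : ψ 1 ≤ v) (x : Vec n) :
    quad Q (truncate ψ v x) ≤ quad Q x := by
  by_cases hconst : IsConstFrom1 ψ
  · rw [truncate, if_pos hconst]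
  · obtain ⟨-, hc, ht⟩ := hψ.2.resolve_right hconst
    have hmem := mem_image_of_growthFunction hc ht hv
    have h1 : 1 ≤ Function.invFunOn ψ (Set.Ici 1) v := Function.invFunOn_mem hmem
    rw [truncate, if_neg hconst, smul_smul, quad_smul]
    refine mul_le_of_le_one_left (quad_nonneg hQ x) ?_
    have h3 : 0 ≤ min ‖x‖ (Function.invFunOn ψ (Set.Ici 1) v) :=
      le_min (norm_nonneg _) (by linarith)
    refine pow_le_one₀ (mul_nonneg h3 (by positivity)) ?_
    calc min ‖x‖ (Function.invFunOn ψ (Set.Ici 1) v) * ‖x‖⁻¹ ≤ ‖x‖ * ‖x‖⁻¹ := by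
          gcongr
          exact min_le_left _ _
      _ ≤ 1 := mul_inv_le_one

theorem IsStepFunction.apply_one_le {φ : Fin m → ℝ → ℝ}
    (hφ : ∀ i, IsGrowthFunction f g i (φ i)) {x₀ : Vec n} {θ K : ℝ} {h : ℝ → ℝ}
    (hh : IsStepFunction φ x₀ θ K h) {Δ : ℝ} (hΔ : Δ ∈ Set.Ioc (0 : ℝ) 1) (i : Fin m) :
    φ i 1 ≤ h Δ := by
  refine le_trans ?_ (hh.lower Δ hΔ i)
  rcases (hφ i).2 with ⟨hm, -, -⟩ | hc
  · exact hm.monotoneOn Set.self_mem_Ici (Set.mem_Ici.mpr (le_max_right _ _)) (le_max_right _ _)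
  · exact (hc _ (le_max_right _ _)).ge

theorem IsGrowthFunction.nonneg {i : Fin m} {ψ : ℝ → ℝ} (hψ : IsGrowthFunction f g i ψ) :
    0 ≤ ψ 1 :=
  le_trans (le_max_of_le_left (by positivity)) (hψ.1 1 le_rfl 0 (by simp))

/-! ### The one-step estimate for the truncated scheme -/

theorem eventually_lintegral_truncated_step_le (hfg : LocallyLip f g)
    {Q : Matrix (Fin n) (Fin n) ℝ} (hQ : Q.PosDef) {pbar p : ℝ} (hp₀ : 0 < p) (hp : p ≤ pbar)
    {α : Fin m → ℝ} (hg : ∀ i, GrowthCondition f g Q pbar i (α i)) {φ : Fin m → ℝ → ℝ}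
    (hφ : ∀ i, IsGrowthFunction f g i (φ i)) {x₀ : Vec n} {θ K : ℝ} (hθ : 0 < θ) {h : ℝ → ℝ}
    (hh : IsStepFunction φ x₀ θ K h) {ε : ℝ} (hε : 0 < ε) :
    ∃ C : ℝ, 0 ≤ C ∧ ∀ᶠ Δ in 𝓝[>] (0 : ℝ), ∀ (i : Fin m) (x y : Vec n),
      y = truncate (φ i) (h Δ) x →
      ∫⁻ ζ, ENNReal.ofReal ((1 + quad Q (y + Δ • f y i
          + WithLp.toLp 2 (g y i *ᵥ (√Δ • ζ).ofLp))) ^ (p / 2)) ∂stdGaussian (Vec d)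
      ≤ ENNReal.ofReal ((1 + quad Q y) ^ (p / 2) * (1 + Δ * (p / 2 * α i + ε)) + C * Δ) := by
  have ha : 0 < p / 2 := by positivity
  -- Half of `ε` is spent here, as `(p/2)(ε/p)`; the other half absorbs the error `(h(Δ)Δ)²`.
  obtain ⟨C₁, hC₁, hdr⟩ := exists_mul_drift_le hfg hQ hp hg (ε := ε / p) (by positivity)
  obtain ⟨C₂, hC₂, hstep⟩ := exists_lintegral_step_le (d := d) hQ ha.le |K|
  refine ⟨p / 2 * C₁, by positivity, ?_⟩
  have hsmall : ∀ᶠ Δ in 𝓝[>] (0 : ℝ), C₂ * K ^ 2 * Δ ^ (2 * θ) ≤ ε / 2 := by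
    have ht : Tendsto (fun Δ : ℝ ↦ C₂ * K ^ 2 * Δ ^ (2 * θ)) (𝓝[>] 0) (𝓝 0) := by
      have h1 : ContinuousAt (fun Δ : ℝ ↦ C₂ * K ^ 2 * Δ ^ (2 * θ)) 0 :=
        continuousAt_const.mul (Real.continuousAt_rpow_const 0 (2 * θ) (Or.inr (by positivity)))
      have h2 := h1.tendsto
      rw [Real.zero_rpow (by positivity), mul_zero] at h2
      exact h2.mono_left nhdsWithin_le_nhds
    exact (ht.eventually_lt_const (by positivity : 0 < ε / 2)).mono fun _ h ↦ h.le
  filter_upwards [hsmall, Ioc_mem_nhdsGT (zero_lt_one' ℝ)] with Δ hΔs hΔ i x y hy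
  have hΔ0 : 0 < Δ := hΔ.1
  have hH1 := hh.apply_one_le hφ hΔ i
  have hH0 : 0 ≤ h Δ := (hφ i).nonneg.trans hH1
  -- Hence `h(Δ)Δ ≤ |K| Δ^(1/2+θ)`, whose square is `Δ` times the vanishing factor `K² Δ^(2θ)`.
  have hsplit : Δ = Δ ^ (1 / 2 - θ) * Δ ^ (1 / 2 + θ) := by
    rw [← Real.rpow_add hΔ0]
    norm_num
  have hK : h Δ * Δ ≤ |K| * Δ ^ (1 / 2 + θ) := by
    calc h Δ * Δ = Δ ^ (1 / 2 - θ) * h Δ * Δ ^ (1 / 2 + θ) := by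
          nth_rewrite 2 [hsplit]
          ring
      _ ≤ |K| * Δ ^ (1 / 2 + θ) := by
          gcongr
          exact (hh.upper Δ hΔ).trans (le_abs_self K)
  have hK1 : h Δ * Δ ≤ |K| := by
    refine hK.trans (mul_le_of_le_one_right (abs_nonneg _) ?_)
    exact Real.rpow_le_one hΔ0.le hΔ.2 (by positivity)
  have hK2 : C₂ * (h Δ * Δ) ^ 2 ≤ ε / 2 * Δ := by
    calc C₂ * (h Δ * Δ) ^ 2 ≤ C₂ * (|K| * Δ ^ (1 / 2 + θ)) ^ 2 := by gcongr
      _ = C₂ * K ^ 2 * Δ ^ (2 * θ) * Δ := by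
          have e : (Δ ^ (1 / 2 + θ)) ^ 2 = Δ ^ (2 * θ) * Δ := by
            rw [← Real.rpow_natCast, ← Real.rpow_mul hΔ0.le]
            nth_rewrite 3 [← Real.rpow_one Δ]
            rw [← Real.rpow_add hΔ0]
            congr 1
            push_cast
            ring
          rw [mul_pow, sq_abs, e]
          ring
      _ ≤ _ := by gcongr
  obtain ⟨hf1, hg1⟩ := growth_truncate (hφ i) hH1 x
  rw [← hy] at hf1 hg1
  refine (hstep (h Δ) Δ y (f y i) (g y i) hH0 hΔ0.le hK1 hf1 hg1).trans
    (ENNReal.ofReal_le_ofReal ?_)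
  have hq := quad_nonneg hQ y
  have hV : 0 < (1 + quad Q y) ^ (p / 2) := Real.rpow_pos_of_pos (by positivity) _
  set V := (1 + quad Q y) ^ (p / 2)
  have e1 := mul_le_mul_of_nonneg_left (hdr i y) (mul_nonneg ha.le hΔ0.le)
  have e2 := mul_le_mul_of_nonneg_left hK2 hV.le
  have e3 : p / 2 * Δ * (V * (α i + ε / p) + C₁) =
      V * (Δ * (p / 2 * α i + ε / 2)) + p / 2 * C₁ * Δ := by
    field_simp
  rw [e3] at e1
  linarith

end coefficients

/-! ### Integration of independent variables and of a Markov chain -/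

theorem lintegral_comp_prodMk_of_indepFun {Ω α β : Type*} [MeasurableSpace Ω] [MeasurableSpace α]
    [MeasurableSpace β] {μ : Measure Ω} [IsProbabilityMeasure μ] {X : Ω → α} {Y : Ω → β}
    (hX : Measurable X) (hY : Measurable Y) (h : IndepFun X Y μ) {Ψ : α × β → ENNReal}
    (hΨ : Measurable Ψ) :
    ∫⁻ ω, Ψ (X ω, Y ω) ∂μ = ∫⁻ ω, ∫⁻ b, Ψ (X ω, b) ∂(μ.map Y) ∂μ := by
  have hmap := (indepFun_iff_map_prod_eq_prod_map_map hX.aemeasurable hY.aemeasurable).mp h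
  have := Measure.isProbabilityMeasure_map (μ := μ) hY.aemeasurable
  have := Measure.isProbabilityMeasure_map (μ := μ) hX.aemeasurable
  calc ∫⁻ ω, Ψ (X ω, Y ω) ∂μ = ∫⁻ q, Ψ q ∂(μ.map fun ω ↦ (X ω, Y ω)) :=
        (lintegral_map hΨ (hX.prodMk hY)).symm
    _ = ∫⁻ a, ∫⁻ b, Ψ (a, b) ∂(μ.map Y) ∂(μ.map X) := by
        rw [hmap, lintegral_prod _ hΨ.aemeasurable]
    _ = _ := lintegral_map hΨ.lintegral_prod_right' hX

/-- As `F` reads only the states up to time `k`, both integrals are finite sums over paths of length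
`k + 1`, compared term by term. -/
theorem lintegral_markov_le {Ω : Type*} [MeasurableSpace Ω] {μ : Measure Ω} {m : ℕ}
    {R : ℕ → Ω → Fin m} (hR : ∀ k, Measurable (R k)) {P : Matrix (Fin m) (Fin m) ℝ} {k : ℕ}
    (hP : ∀ (ρ : ℕ → Fin m) (j : Fin m), μ ({ω | ∀ l ≤ k, R l ω = ρ l} ∩ {ω | R (k + 1) ω = j}) ≤
      μ {ω | ∀ l ≤ k, R l ω = ρ l} * ENNReal.ofReal (P (ρ k) j))
    (w : Fin m → ENNReal) {F : (ℕ → Fin m) → ENNReal}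
    (hF : ∀ ρ ρ' : ℕ → Fin m, (∀ l ≤ k, ρ l = ρ' l) → F ρ = F ρ') :
    ∫⁻ ω, w (R (k + 1) ω) * F (fun l ↦ R l ω) ∂μ ≤
      ∫⁻ ω, (∑ j, ENNReal.ofReal (P (R k ω) j) * w j) * F (fun l ↦ R l ω) ∂μ := by
  -- Finite paths are continued by their last state; by `hF` the continuation does not affect `F`.
  set ext : (Fin (k + 1) → Fin m) → ℕ → Fin m := fun σ l ↦ σ ⟨min l k, by omega⟩ with hext
  set S : Ω → Fin (k + 1) → Fin m := fun ω l ↦ R l ω with hS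
  have hSm : Measurable S := measurable_pi_lambda _ fun l ↦ hR l
  have hFS : ∀ ω, F (fun l ↦ R l ω) = F (ext (S ω)) := fun ω ↦
    hF _ _ fun l hl ↦ by simp [hext, hS, hl]
  have hSset : ∀ σ, {ω | S ω = σ} = {ω | ∀ l ≤ k, R l ω = ext σ l} := by
    intro σ
    ext ω
    constructor
    · rintro rfl l hl
      simp [hext, hS, hl]
    · intro h
      funext l
      have hl : (l : ℕ) ≤ k := by omega
      have := h l hl
      simpa [hext, hS, hl] using this
  have hL : ∫⁻ ω, w (R (k + 1) ω) * F (fun l ↦ R l ω) ∂μ =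
      ∑ q : (Fin (k + 1) → Fin m) × Fin m,
        w q.2 * F (ext q.1) * μ ({ω | S ω = q.1} ∩ {ω | R (k + 1) ω = q.2}) := by
    have h1 : ∫⁻ ω, w (R (k + 1) ω) * F (fun l ↦ R l ω) ∂μ =
        ∫⁻ q, w q.2 * F (ext q.1) ∂(μ.map fun ω ↦ (S ω, R (k + 1) ω)) := by
      rw [lintegral_map (measurable_of_countable _) (hSm.prodMk (hR _))]
      exact lintegral_congr fun ω ↦ by rw [hFS]
    rw [h1, lintegral_fintype]
    refine Finset.sum_congr rfl fun q _ ↦ ?_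
    rw [Measure.map_apply (hSm.prodMk (hR _)) (measurableSet_singleton _)]
    congr 2
    ext ω
    simp [Prod.ext_iff]
  have hRt : ∫⁻ ω, (∑ j, ENNReal.ofReal (P (R k ω) j) * w j) * F (fun l ↦ R l ω) ∂μ =
      ∑ σ : Fin (k + 1) → Fin m,
        (∑ j, ENNReal.ofReal (P (ext σ k) j) * w j) * F (ext σ) * μ {ω | S ω = σ} := by
    have h1 : ∫⁻ ω, (∑ j, ENNReal.ofReal (P (R k ω) j) * w j) * F (fun l ↦ R l ω) ∂μ =
        ∫⁻ σ, (∑ j, ENNReal.ofReal (P (ext σ k) j) * w j) * F (ext σ) ∂(μ.map S) := by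
      rw [lintegral_map (measurable_of_countable _) hSm]
      refine lintegral_congr fun ω ↦ ?_
      have e : R k ω = ext (S ω) k := by simp [hext, hS]
      rw [hFS]
      exact congrArg (fun i ↦ (∑ j, ENNReal.ofReal (P i j) * w j) * F (ext (S ω))) e
    rw [h1, lintegral_fintype]
    refine Finset.sum_congr rfl fun σ _ ↦ ?_
    rw [Measure.map_apply hSm (measurableSet_singleton _)]
    rfl
  rw [hL, hRt, Fintype.sum_prod_type]
  refine Finset.sum_le_sum fun σ _ ↦ ?_
  rw [Finset.sum_mul, Finset.sum_mul]
  refine Finset.sum_le_sum fun j _ ↦ ?_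
  have h2 := hP (ext σ) j
  rw [← hSset] at h2
  calc w j * F (ext σ) * μ ({ω | S ω = σ} ∩ {ω | R (k + 1) ω = j})
      ≤ w j * F (ext σ) * (μ {ω | S ω = σ} * ENNReal.ofReal (P (ext σ k) j)) := by gcongr
    _ = _ := by ring

theorem measure_markov_eq {Ω : Type*} [MeasurableSpace Ω] {μ : Measure Ω} [IsProbabilityMeasure μ]
    {m : ℕ} {r : ℝ≥0 → Ω → Fin m} {P : ℝ≥0 → Matrix (Fin m) (Fin m) ℝ}
    (hP : ∀ (s t : ℝ≥0) (A : Set Ω),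
      MeasurableSet[⨆ u : Set.Iic s, MeasurableSpace.comap (r u) inferInstance] A →
      ∀ i j, μ.real (A ∩ {ω | r s ω = i} ∩ {ω | r (s + t) ω = j}) =
        μ.real (A ∩ {ω | r s ω = i}) * P t i j)
    (Δ : ℝ≥0) (k : ℕ) (ρ : ℕ → Fin m) (j : Fin m) :
    μ ({ω | ∀ l ≤ k, r (l * Δ) ω = ρ l} ∩ {ω | r ((k + 1 : ℕ) * Δ) ω = j}) =
      μ {ω | ∀ l ≤ k, r (l * Δ) ω = ρ l} * ENNReal.ofReal (P Δ (ρ k) j) := by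
  set A : Set Ω := {ω | ∀ l ≤ k, r (l * Δ) ω = ρ l} with hA
  have hAm : MeasurableSet[⨆ u : Set.Iic ((k : ℝ≥0) * Δ),
      MeasurableSpace.comap (r u) inferInstance] A := by
    have : A = ⋂ l ∈ Set.Iic k, (r (l * Δ)) ⁻¹' {ρ l} := by
      ext ω
      simp [hA]
    rw [this]
    refine MeasurableSet.biInter (Set.to_countable _) fun l hl ↦ ?_
    have hle : (l : ℝ≥0) * Δ ≤ k * Δ := by
      gcongr
      exact hl
    exact le_iSup (fun u : Set.Iic ((k : ℝ≥0) * Δ) ↦ MeasurableSpace.comap (r u) inferInstance)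
      ⟨_, hle⟩ _ ⟨{ρ l}, measurableSet_singleton _, rfl⟩
  have h1 := hP (k * Δ) Δ A hAm (ρ k) j
  have h2 : A ∩ {ω | r (k * Δ) ω = ρ k} = A :=
    Set.inter_eq_left.mpr fun ω hω ↦ hω k le_rfl
  have h3 : ((k + 1 : ℕ) : ℝ≥0) * Δ = k * Δ + Δ := by push_cast; ring
  rw [h2, ← h3] at h1
  rw [← ofReal_measureReal (s := A ∩ _), h1, ENNReal.ofReal_mul measureReal_nonneg,
    ofReal_measureReal]

/-! ### The scheme along a fixed path of the chain -/

section path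
variable {n d m : ℕ} (f : Vec n → Fin m → Vec n) (g : Vec n → Fin m → Matrix (Fin n) (Fin d) ℝ)
  (φ : Fin m → ℝ → ℝ) (h : ℝ → ℝ) (x₀ : Vec n) (Δ : ℝ)

/-- The untruncated iterates driven by a path `ρ` of the chain and a sequence `z` of increments. -/
noncomputable def pathTilde (ρ : ℕ → Fin m) (z : ℕ → Vec d) : ℕ → Vec n
  | 0 => x₀
  | k + 1 =>
    let y := truncate (φ (ρ k)) (h Δ) (pathTilde ρ z k)
    y + Δ • f y (ρ k) + WithLp.toLp 2 (g y (ρ k) *ᵥ (z k).ofLp)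

/-- The truncated iterates driven by a path `ρ` of the chain and a sequence `z` of increments. -/
noncomputable def pathEM (ρ : ℕ → Fin m) (z : ℕ → Vec d) (k : ℕ) : Vec n :=
  truncate (φ (ρ k)) (h Δ) (pathTilde f g φ h x₀ Δ ρ z k)

theorem pathTilde_succ (ρ : ℕ → Fin m) (z : ℕ → Vec d) (k : ℕ) :
    pathTilde f g φ h x₀ Δ ρ z (k + 1) =
      pathEM f g φ h x₀ Δ ρ z k + Δ • f (pathEM f g φ h x₀ Δ ρ z k) (ρ k)
        + WithLp.toLp 2 (g (pathEM f g φ h x₀ Δ ρ z k) (ρ k) *ᵥ (z k).ofLp) := rfl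

/-- Exhibits the scheme as a deterministic function of two independent sequences, the sampled chain
and the increments, so that Fubini's theorem can freeze the chain. -/
theorem emTilde_eq_pathTilde {Ω : Type*} (B : ℝ≥0 → Ω → Vec d) (r : ℝ≥0 → Ω → Fin m) (δ : ℝ≥0)
    (k : ℕ) (ω : Ω) :
    emTilde f g φ h B r x₀ δ k ω = pathTilde f g φ h x₀ δ (fun l ↦ r (l * δ) ω)
      (fun l ↦ B ((l + 1 : ℕ) * δ) ω - B (l * δ) ω) k := by
  induction k with
  | zero => rfl
  | succ k ih =>
    simp only [emTilde, pathTilde, ih]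
    push_cast
    rfl

theorem em_eq_pathEM {Ω : Type*} (B : ℝ≥0 → Ω → Vec d) (r : ℝ≥0 → Ω → Fin m) (δ : ℝ≥0)
    (k : ℕ) (ω : Ω) :
    em f g φ h B r x₀ δ k ω = pathEM f g φ h x₀ δ (fun l ↦ r (l * δ) ω)
      (fun l ↦ B ((l + 1 : ℕ) * δ) ω - B (l * δ) ω) k := by
  rw [em, emTilde_eq_pathTilde, pathEM]

theorem pathTilde_congr {ρ ρ' : ℕ → Fin m} {z z' : ℕ → Vec d} {k : ℕ}
    (hρ : ∀ l < k, ρ l = ρ' l) (hz : ∀ l < k, z l = z' l) :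
    pathTilde f g φ h x₀ Δ ρ z k = pathTilde f g φ h x₀ Δ ρ' z' k := by
  induction k with
  | zero => rfl
  | succ k ih =>
    have h1 := ih (fun l hl ↦ hρ l (by omega)) (fun l hl ↦ hz l (by omega))
    simp only [pathTilde, h1, hρ k (by omega), hz k (by omega)]

/-- The state at time `k` matters, because it selects the truncation, whereas the increment `z k` is
not yet used. -/
theorem pathEM_congr {ρ ρ' : ℕ → Fin m} {z z' : ℕ → Vec d} {k : ℕ}
    (hρ : ∀ l ≤ k, ρ l = ρ' l) (hz : ∀ l < k, z l = z' l) :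
    pathEM f g φ h x₀ Δ ρ z k = pathEM f g φ h x₀ Δ ρ' z' k := by
  rw [pathEM, pathEM, hρ k le_rfl,
    pathTilde_congr f g φ h x₀ Δ (fun l hl ↦ hρ l hl.le) hz]

variable {f g}

theorem measurable_step (hfg : LocallyLip f g) (i : Fin m) :
    Measurable fun q : Vec n × Vec d ↦
      q.1 + Δ • f q.1 i + WithLp.toLp 2 (g q.1 i *ᵥ q.2.ofLp) := by
  have hf := hfg.continuous_drift i
  have hg := hfg.continuous_diffusion i
  refine Continuous.measurable ?_
  fun_prop

theorem measurable_pathTilde (hfg : LocallyLip f g) (k : ℕ) :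
    Measurable fun q : (ℕ → Fin m) × (ℕ → Vec d) ↦ pathTilde f g φ h x₀ Δ q.1 q.2 k := by
  induction k with
  | zero => exact measurable_const
  | succ k ih =>
    have h1 : Measurable fun t : Fin m × (Vec n × Vec d) ↦
        truncate (φ t.1) (h Δ) t.2.1 + Δ • f (truncate (φ t.1) (h Δ) t.2.1) t.1
          + WithLp.toLp 2 (g (truncate (φ t.1) (h Δ) t.2.1) t.1 *ᵥ t.2.2.ofLp) := by
      refine measurable_from_prod_countable_right fun i ↦ ?_
      exact (measurable_step Δ hfg i).comp
        (((measurable_truncate (φ i) (h Δ)).comp measurable_fst).prodMk measurable_snd)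
    exact h1.comp (((measurable_pi_apply k).comp measurable_fst).prodMk
      (ih.prodMk ((measurable_pi_apply k).comp measurable_snd)))

theorem measurable_pathEM (hfg : LocallyLip f g) (k : ℕ) :
    Measurable fun q : (ℕ → Fin m) × (ℕ → Vec d) ↦ pathEM f g φ h x₀ Δ q.1 q.2 k := by
  have h1 : Measurable fun t : Fin m × Vec n ↦ truncate (φ t.1) (h Δ) t.2 :=
    measurable_from_prod_countable_right fun i ↦ measurable_truncate (φ i) (h Δ)
  exact h1.comp (((measurable_pi_apply k).comp measurable_fst).prodMk
    (measurable_pathTilde φ h x₀ Δ hfg k))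

/-- For a fixed path of the chain, the current iterate is independent of the next increment. -/
theorem indepFun_pathEM (hfg : LocallyLip f g) {Ω : Type*} [MeasurableSpace Ω] {μ : Measure Ω}
    {Z : ℕ → Ω → Vec d} (hZ : ∀ k, Measurable (Z k)) (hind : iIndepFun Z μ) (ρ : ℕ → Fin m)
    (k : ℕ) :
    IndepFun (fun ω ↦ pathEM f g φ h x₀ Δ ρ (fun l ↦ Z l ω) k) (Z k) μ := by
  have h1 := hind.indepFun_finset (Finset.range k) {k} (by simp) hZ
  set ext : (Finset.range k → Vec d) → ℕ → Vec d :=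
    fun s l ↦ if hl : l ∈ Finset.range k then s ⟨l, hl⟩ else 0 with hext
  have hextm : Measurable ext := by
    refine measurable_pi_lambda _ fun l ↦ ?_
    simp only [hext]
    split_ifs with hl
    · exact measurable_pi_apply _
    · exact measurable_const
  have hlast : Measurable fun s : ({k} : Finset ℕ) → Vec d ↦ s ⟨k, Finset.mem_singleton_self k⟩ :=
    measurable_pi_apply _
  have h2 := h1.comp (φ := fun s ↦ pathEM f g φ h x₀ Δ ρ (ext s) k)
    ((measurable_pathEM φ h x₀ Δ hfg k).comp (measurable_const.prodMk hextm))
    hlast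
  convert h2 using 1
  · funext ω
    refine pathEM_congr f g φ h x₀ Δ (fun _ _ ↦ rfl) fun l hl ↦ ?_
    simp [hext, hl]
  · rfl

end path

/-! ### Moments of the scheme along a fixed path of the chain -/

section moments
variable {Ω : Type*} [MeasurableSpace Ω] {n d m : ℕ} (f : Vec n → Fin m → Vec n)
  (g : Vec n → Fin m → Matrix (Fin n) (Fin d) ℝ) (φ : Fin m → ℝ → ℝ) (h : ℝ → ℝ) (x₀ : Vec n)
  (Δ : ℝ) (Q : Matrix (Fin n) (Fin n) ℝ) (a : ℝ) (μ : Measure Ω) (Z : ℕ → Ω → Vec d)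

/-- The expectation of `(1 + yᵀQy)^a` at the `k`-th iterate along the path `ρ` of the chain. -/
noncomputable def pathMoment (ρ : ℕ → Fin m) (k : ℕ) : ENNReal :=
  ∫⁻ ω, ENNReal.ofReal ((1 + quad Q (pathEM f g φ h x₀ Δ ρ (fun l ↦ Z l ω) k)) ^ a) ∂μ

variable {f g φ h x₀ Δ Q a μ Z}

theorem pathMoment_congr {ρ ρ' : ℕ → Fin m} {k : ℕ} (hρ : ∀ l ≤ k, ρ l = ρ' l) :
    pathMoment f g φ h x₀ Δ Q a μ Z ρ k = pathMoment f g φ h x₀ Δ Q a μ Z ρ' k := by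
  unfold pathMoment
  refine lintegral_congr fun ω ↦ ?_
  rw [pathEM_congr f g φ h x₀ Δ hρ fun _ _ ↦ rfl]

theorem measurable_one_add_quad_rpow : Measurable fun x : Vec n ↦
    ENNReal.ofReal ((1 + quad Q x) ^ a) :=
  ENNReal.measurable_ofReal.comp
    ((measurable_const.add continuous_quad.measurable).pow_const a)

/-- Truncation does not increase `xᵀQx`, so the bound for the untruncated iterate suffices. The
current iterate is independent of the next increment, which is therefore integrated out first. -/
theorem pathMoment_succ_le [IsProbabilityMeasure μ] (hfg : LocallyLip f g) (hQ : Q.PosDef)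
    (ha : 0 ≤ a) (hφ : ∀ i, IsGrowthFunction f g i (φ i)) (hφh : ∀ i, φ i 1 ≤ h Δ)
    (hZ : ∀ k, Measurable (Z k)) (hind : iIndepFun Z μ)
    (hlaw : ∀ k, μ.map (Z k) = (stdGaussian (Vec d)).map fun ζ ↦ √Δ • ζ)
    {A : Fin m → ℝ} {C : ℝ}
    (hstep : ∀ (i : Fin m) (x y : Vec n), y = truncate (φ i) (h Δ) x →
      ∫⁻ ζ, ENNReal.ofReal ((1 + quad Q (y + Δ • f y i
          + WithLp.toLp 2 (g y i *ᵥ (√Δ • ζ).ofLp))) ^ a) ∂stdGaussian (Vec d)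
      ≤ ENNReal.ofReal ((1 + quad Q y) ^ a * A i + C))
    (ρ : ℕ → Fin m) (k : ℕ) :
    pathMoment f g φ h x₀ Δ Q a μ Z ρ (k + 1) ≤
      ENNReal.ofReal (A (ρ k)) * pathMoment f g φ h x₀ Δ Q a μ Z ρ k + ENNReal.ofReal C := by
  set Y : Ω → Vec n := fun ω ↦ pathEM f g φ h x₀ Δ ρ (fun l ↦ Z l ω) k with hY
  have hYm : Measurable Y := (measurable_pathEM φ h x₀ Δ hfg k).comp
    (measurable_const.prodMk (measurable_pi_lambda _ hZ))
  set Ψ : Vec n × Vec d → ENNReal := fun q ↦ ENNReal.ofReal ((1 + quad Q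
    (q.1 + Δ • f q.1 (ρ k) + WithLp.toLp 2 (g q.1 (ρ k) *ᵥ q.2.ofLp))) ^ a) with hΨ
  have hΨm : Measurable Ψ := measurable_one_add_quad_rpow.comp (measurable_step Δ hfg (ρ k))
  have hVm : Measurable fun ω ↦ ENNReal.ofReal ((1 + quad Q (Y ω)) ^ a) :=
    measurable_one_add_quad_rpow.comp hYm
  calc pathMoment f g φ h x₀ Δ Q a μ Z ρ (k + 1) ≤ ∫⁻ ω, Ψ (Y ω, Z k ω) ∂μ := by
        refine lintegral_mono fun ω ↦ ENNReal.ofReal_le_ofReal ?_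
        have h1 := quad_truncate_le hQ (hφ (ρ (k + 1))) (hφh (ρ (k + 1)))
          (pathTilde f g φ h x₀ Δ ρ (fun l ↦ Z l ω) (k + 1))
        have h2 := quad_nonneg hQ (pathEM f g φ h x₀ Δ ρ (fun l ↦ Z l ω) (k + 1))
        refine Real.rpow_le_rpow (by positivity) ?_ ha
        rw [pathTilde_succ] at h1
        exact add_le_add_right h1 1
    _ = ∫⁻ ω, ∫⁻ z, Ψ (Y ω, z) ∂(μ.map (Z k)) ∂μ :=
        lintegral_comp_prodMk_of_indepFun hYm (hZ k) (indepFun_pathEM φ h x₀ Δ hfg hZ hind ρ k) hΨm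
    _ ≤ ∫⁻ ω, (ENNReal.ofReal (A (ρ k)) * ENNReal.ofReal ((1 + quad Q (Y ω)) ^ a)
          + ENNReal.ofReal C) ∂μ := by
        refine lintegral_mono fun ω ↦ ?_
        have hm : Measurable fun z ↦ Ψ (Y ω, z) := hΨm.comp measurable_prodMk_left
        have hq := quad_nonneg hQ (Y ω)
        simp only
        rw [hlaw k, lintegral_map hm (by fun_prop)]
        -- Subadditivity of `ENNReal.ofReal` holds for either sign of `A` and `C`.
        refine (hstep (ρ k) _ (Y ω) rfl).trans (ENNReal.ofReal_add_le.trans ?_)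
        rw [ENNReal.ofReal_mul (by positivity), mul_comm]
    _ = _ := by
        rw [lintegral_add_left (hVm.const_mul _), lintegral_const_mul _ hVm]
        simp [pathMoment, hY]

/-! ### The weighted moments of the scheme -/

variable {R : ℕ → Ω → Fin m} {ξ : Fin m → ℝ}

theorem lintegral_weighted_eq [IsProbabilityMeasure μ] (hfg : LocallyLip f g)
    (hZ : ∀ k, Measurable (Z k)) (hR : ∀ k, Measurable (R k))
    (hRZ : IndepFun (fun ω k ↦ R k ω) (fun ω k ↦ Z k ω) μ) (ξ : Fin m → ℝ) (k : ℕ) :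
    ∫⁻ ω, ENNReal.ofReal (ξ (R k ω)) * ENNReal.ofReal ((1 + quad Q
        (pathEM f g φ h x₀ Δ (fun l ↦ R l ω) (fun l ↦ Z l ω) k)) ^ a) ∂μ =
      ∫⁻ ω, ENNReal.ofReal (ξ (R k ω)) *
        pathMoment f g φ h x₀ Δ Q a μ Z (fun l ↦ R l ω) k ∂μ := by
  have hZm : Measurable fun ω k ↦ Z k ω := measurable_pi_lambda _ hZ
  have hRm : Measurable fun ω k ↦ R k ω := measurable_pi_lambda _ hR
  set W : (ℕ → Fin m) × (ℕ → Vec d) → ENNReal := fun q ↦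
    ENNReal.ofReal ((1 + quad Q (pathEM f g φ h x₀ Δ q.1 q.2 k)) ^ a) with hW
  have hWm : Measurable W := measurable_one_add_quad_rpow.comp (measurable_pathEM φ h x₀ Δ hfg k)
  set Ψ : (ℕ → Fin m) × (ℕ → Vec d) → ENNReal := fun q ↦ ENNReal.ofReal (ξ (q.1 k)) * W q with hΨ
  have hξm : Measurable fun i : Fin m ↦ ENNReal.ofReal (ξ i) := measurable_of_countable _
  have hΨm : Measurable Ψ :=
    (hξm.comp ((measurable_pi_apply k).comp measurable_fst)).mul hWm
  refine (lintegral_comp_prodMk_of_indepFun hRm hZm hRZ hΨm).trans (lintegral_congr fun ω ↦ ?_)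
  have hm : Measurable fun z ↦ W (fun l ↦ R l ω, z) := hWm.comp measurable_prodMk_left
  simp only [hΨ]
  rw [lintegral_const_mul _ hm, lintegral_map hm hZm]
  rfl

/-- The moment at time `k + 1` depends on the new state through the truncation. It is first replaced
by its bound, which depends on the path up to `k` only; then the Markov property averages `ξ (R (k +
1))` alone. -/
theorem lintegral_weighted_succ_le [IsProbabilityMeasure μ] (hR : ∀ k, Measurable (R k))
    {A : Fin m → ℝ} {C κ W : ℝ} {P : Matrix (Fin m) (Fin m) ℝ} {k : ℕ}
    (hstep : ∀ ρ : ℕ → Fin m, pathMoment f g φ h x₀ Δ Q a μ Z ρ (k + 1) ≤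
      ENNReal.ofReal (A (ρ k)) * pathMoment f g φ h x₀ Δ Q a μ Z ρ k + ENNReal.ofReal C)
    (hP : ∀ (ρ : ℕ → Fin m) (j : Fin m), μ ({ω | ∀ l ≤ k, R l ω = ρ l} ∩ {ω | R (k + 1) ω = j}) ≤
      μ {ω | ∀ l ≤ k, R l ω = ρ l} * ENNReal.ofReal (P (ρ k) j))
    (hPA : ∀ i, (∑ j, ENNReal.ofReal (P i j) * ENNReal.ofReal (ξ j)) * ENNReal.ofReal (A i) ≤
      ENNReal.ofReal κ * ENNReal.ofReal (ξ i))
    (hPW : ∀ i, ∑ j, ENNReal.ofReal (P i j) * ENNReal.ofReal (ξ j) ≤ ENNReal.ofReal W) :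
    ∫⁻ ω, ENNReal.ofReal (ξ (R (k + 1) ω)) *
        pathMoment f g φ h x₀ Δ Q a μ Z (fun l ↦ R l ω) (k + 1) ∂μ ≤
      ENNReal.ofReal κ * ∫⁻ ω, ENNReal.ofReal (ξ (R k ω)) *
        pathMoment f g φ h x₀ Δ Q a μ Z (fun l ↦ R l ω) k ∂μ
      + ENNReal.ofReal W * ENNReal.ofReal C := by
  set F : (ℕ → Fin m) → ENNReal := fun ρ ↦
    ENNReal.ofReal (A (ρ k)) * pathMoment f g φ h x₀ Δ Q a μ Z ρ k + ENNReal.ofReal C with hFdef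
  have hF : ∀ ρ ρ' : ℕ → Fin m, (∀ l ≤ k, ρ l = ρ' l) → F ρ = F ρ' := by
    intro ρ ρ' hρ
    simp only [hFdef, hρ k le_rfl, pathMoment_congr hρ]
  calc _ ≤ ∫⁻ ω, ENNReal.ofReal (ξ (R (k + 1) ω)) * F (fun l ↦ R l ω) ∂μ :=
        lintegral_mono fun ω ↦ mul_le_mul_right (hstep _) _
    _ ≤ ∫⁻ ω, (∑ j, ENNReal.ofReal (P (R k ω) j) * ENNReal.ofReal (ξ j)) *
          F (fun l ↦ R l ω) ∂μ := lintegral_markov_le hR hP _ hF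
    _ ≤ ∫⁻ ω, (ENNReal.ofReal κ * (ENNReal.ofReal (ξ (R k ω)) *
          pathMoment f g φ h x₀ Δ Q a μ Z (fun l ↦ R l ω) k)
          + ENNReal.ofReal W * ENNReal.ofReal C) ∂μ := by
        refine lintegral_mono fun ω ↦ ?_
        simp only [hFdef]
        rw [mul_add, ← mul_assoc, ← mul_assoc]
        exact add_le_add (mul_le_mul_left (hPA _) _) (mul_le_mul_left (hPW _) _)
    _ = _ := by
        rw [lintegral_add_right _ measurable_const, lintegral_const_mul' _ _ ENNReal.ofReal_ne_top]
        simp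

end moments

/-! ### Choice of the step size -/

/-- The `o(δ)` terms are at most `ηδ`, so each transition probability is bounded by `1_{ij} + Γ_ij δ
+ ηδ`. For small `δ` these bounds are nonnegative, hence compatible with `ENNReal.ofReal`. -/
theorem eventually_transition_bounds {m : ℕ} {Γ : Matrix (Fin m) (Fin m) ℝ} (hΓ : IsGenerator Γ)
    {P : ℝ≥0 → Matrix (Fin m) (Fin m) ℝ}
    (hP : ∀ i j, (fun δ : ℝ≥0 ↦ P δ i j - ((1 : Matrix (Fin m) (Fin m) ℝ) i j + Γ i j * δ))
      =o[𝓝[>] 0] (fun δ : ℝ≥0 ↦ (δ : ℝ))) {ξ : Fin m → ℝ} (hξ : ∀ i, 0 < ξ i)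
    {η : ℝ} (hη : 0 < η) :
    ∀ᶠ δ : ℝ≥0 in 𝓝[>] 0, ∀ i, 0 ≤ ξ i + δ * ((Γ *ᵥ ξ) i + η * ∑ j, ξ j) ∧
      ∑ j, ENNReal.ofReal (P δ i j) * ENNReal.ofReal (ξ j) ≤
        ENNReal.ofReal (ξ i + δ * ((Γ *ᵥ ξ) i + η * ∑ j, ξ j)) := by
  have h1 : ∀ᶠ δ : ℝ≥0 in 𝓝[>] 0, ∀ i j,
      ‖P δ i j - ((1 : Matrix (Fin m) (Fin m) ℝ) i j + Γ i j * δ)‖ ≤ η * ‖(δ : ℝ)‖ :=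
    eventually_all.mpr fun i ↦ eventually_all.mpr fun j ↦ (hP i j).def hη
  have h2 : ∀ᶠ δ : ℝ≥0 in 𝓝[>] 0, ∀ i, 0 ≤ 1 + Γ i i * δ := by
    refine eventually_all.mpr fun i ↦ ?_
    have hc : Continuous fun δ : ℝ≥0 ↦ 1 + Γ i i * (δ : ℝ) := by fun_prop
    have ht : Tendsto (fun δ : ℝ≥0 ↦ 1 + Γ i i * (δ : ℝ)) (𝓝[>] 0) (𝓝 1) := by
      have := hc.tendsto 0
      simp only [NNReal.coe_zero, mul_zero, add_zero] at this
      exact this.mono_left nhdsWithin_le_nhds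
    exact (ht.eventually_const_lt zero_lt_one).mono fun _ h ↦ h.le
  filter_upwards [h1, h2] with δ hδ1 hδ2 i
  set p : Fin m → ℝ := fun j ↦ (1 : Matrix (Fin m) (Fin m) ℝ) i j + Γ i j * δ + η * δ with hp
  have hδ : 0 ≤ (δ : ℝ) := δ.2
  have hp0 : ∀ j, 0 ≤ p j := by
    intro j
    have h3 : 0 ≤ η * (δ : ℝ) := by positivity
    by_cases hij : i = j
    · subst hij
      simp only [hp, Matrix.one_apply_eq]
      linarith [hδ2 i]
    · simp only [hp, Matrix.one_apply_ne hij]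
      have := mul_nonneg (hΓ.1 i j hij) hδ
      linarith
  have hPp : ∀ j, P δ i j ≤ p j := by
    intro j
    have := (le_abs_self _).trans (hδ1 i j)
    rw [Real.norm_of_nonneg hδ] at this
    simp only [hp]
    linarith
  have hsum : ∑ j, p j * ξ j = ξ i + δ * ((Γ *ᵥ ξ) i + η * ∑ j, ξ j) := by
    simp only [hp, add_mul, Finset.sum_add_distrib, Matrix.mulVec, dotProduct, mul_add,
      Finset.mul_sum]
    have : ∑ j, (1 : Matrix (Fin m) (Fin m) ℝ) i j * ξ j = ξ i := by simp [Matrix.one_apply]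
    rw [this, add_assoc]
    congr 2 <;> exact Finset.sum_congr rfl fun j _ ↦ by ring
  rw [← hsum]
  refine ⟨Finset.sum_nonneg fun j _ ↦ mul_nonneg (hp0 j) (hξ j).le, ?_⟩
  rw [ENNReal.ofReal_sum_of_nonneg fun j _ ↦ mul_nonneg (hp0 j) (hξ j).le]
  refine Finset.sum_le_sum fun j _ ↦ ?_
  rw [ENNReal.ofReal_mul (hp0 j)]
  gcongr
  exact hPp j

/-- Existence of step sizes for which the weighted moments contract, up to a constant. -/
theorem eventually_contraction {m : ℕ} {Γ : Matrix (Fin m) (Fin m) ℝ} {ξ β : Fin m → ℝ}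
    (hξ : ∀ i, 0 < ξ i) (hΓξ : ∀ i, (Γ *ᵥ ξ) i + β i * ξ i = -1) {η : ℝ}
    (hη : η = 1 / (8 * (1 + ∑ j, ξ j))) :
    ∀ᶠ δ : ℝ≥0 in 𝓝[>] 0, ∀ i,
      (ξ i + δ * ((Γ *ᵥ ξ) i + η * ∑ j, ξ j)) * (1 + δ * (β i + η)) ≤
        (1 - 1 / (2 * (1 + ∑ j, ξ j)) * δ) * ξ i := by
  set S := ∑ j, ξ j with hS
  have hS0 : 0 ≤ S := Finset.sum_nonneg fun j _ ↦ (hξ j).le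
  have hηS : η * (1 + S) = 1 / 8 := by rw [hη]; field_simp
  have hη0 : 0 < η := by rw [hη]; positivity
  refine eventually_all.mpr fun i ↦ ?_
  have hξS : ξ i ≤ S := Finset.single_le_sum (fun j _ ↦ (hξ j).le) (Finset.mem_univ i)
  set J := ((Γ *ᵥ ξ) i + η * S) * (β i + η) with hJ
  have hsmall : ∀ᶠ δ : ℝ≥0 in 𝓝[>] 0, δ * J ≤ 1 / 4 := by
    have hc : Continuous fun δ : ℝ≥0 ↦ (δ : ℝ) * J := by fun_prop
    have ht : Tendsto (fun δ : ℝ≥0 ↦ (δ : ℝ) * J) (𝓝[>] 0) (𝓝 0) := by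
      have := hc.tendsto 0
      simp only [NNReal.coe_zero, zero_mul] at this
      exact this.mono_left nhdsWithin_le_nhds
    exact (ht.eventually_lt_const (by norm_num : (0 : ℝ) < 1 / 4)).mono fun _ h ↦ h.le
  filter_upwards [hsmall] with δ hδ
  have hδ0 : 0 ≤ (δ : ℝ) := δ.2
  -- The first-order coefficient is `-1` by the choice of `ξ`. The errors `ηS`, `ηξ_i` and `δJ` are
  -- at most `1/8`, `1/8` and `1/4`, which leaves `-1/2`; this is at most `-κ ξ_i` for `κ =
  -- 1/(2(1+S))`.
  have e : (ξ i + δ * ((Γ *ᵥ ξ) i + η * S)) * (1 + δ * (β i + η)) =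
      ξ i + δ * (((Γ *ᵥ ξ) i + β i * ξ i) + η * S + η * ξ i + δ * J) := by
    rw [hJ]; ring
  rw [e, hΓξ i]
  have h1 : η * S ≤ 1 / 8 := by nlinarith
  have h2 : η * ξ i ≤ 1 / 8 := by nlinarith
  have h3 : 1 / (2 * (1 + S)) * ξ i ≤ 1 / 2 := by
    rw [one_div, inv_mul_le_iff₀ (by positivity)]
    linarith
  have h4 : (δ : ℝ) * (-1 + η * S + η * ξ i + δ * J) ≤ δ * (-(1 / (2 * (1 + S)) * ξ i)) :=
    mul_le_mul_of_nonneg_left (by linarith) hδ0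
  linarith

theorem le_of_affine_recursion {U : ℕ → ENNReal} {κ D b : ℝ} (hκ : 0 ≤ κ) (hD : 0 ≤ D)
    (hb : 0 ≤ b) (hfix : κ * b + D ≤ b) (h0 : U 0 ≤ ENNReal.ofReal b)
    (hU : ∀ k, U (k + 1) ≤ ENNReal.ofReal κ * U k + ENNReal.ofReal D) (k : ℕ) :
    U k ≤ ENNReal.ofReal b := by
  induction k with
  | zero => exact h0
  | succ k ih =>
    calc U (k + 1) ≤ ENNReal.ofReal κ * ENNReal.ofReal b + ENNReal.ofReal D :=
          (hU k).trans (by gcongr)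
      _ = ENNReal.ofReal (κ * b + D) := by
          rw [ENNReal.ofReal_add (by positivity) hD, ENNReal.ofReal_mul hκ]
      _ ≤ _ := ENNReal.ofReal_le_ofReal hfix

/-! ### The moment bound -/

theorem integrable_and_integral_le_of_lintegral_le {Ω : Type*} [MeasurableSpace Ω] {μ : Measure Ω}
    {F : Ω → ℝ} (hF : Measurable F) (hF0 : ∀ ω, 0 ≤ F ω) {C : ℝ} (hC : 0 ≤ C)
    (h : ∫⁻ ω, ENNReal.ofReal (F ω) ∂μ ≤ ENNReal.ofReal C) :
    Integrable F μ ∧ ∫ ω, F ω ∂μ ≤ C := by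
  constructor
  · rw [← lintegral_ofReal_ne_top_iff_integrable hF.aestronglyMeasurable (ae_of_all _ hF0)]
    exact (h.trans_lt ENNReal.ofReal_lt_top).ne
  · rw [integral_eq_lintegral_of_nonneg_ae (ae_of_all _ hF0) hF.aestronglyMeasurable]
    exact ENNReal.toReal_le_of_le_ofReal hC h

theorem exists_norm_rpow_le {n : ℕ} {Q : Matrix (Fin n) (Fin n) ℝ} (hQ : Q.PosDef) {p : ℝ}
    (hp : 0 < p) : ∃ c : ℝ, 0 ≤ c ∧ ∀ y : Vec n, ‖y‖ ^ p ≤ c * (1 + quad Q y) ^ (p / 2) := by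
  obtain ⟨c, hc, h⟩ := exists_le_quad hQ
  refine ⟨c⁻¹ ^ (p / 2), by positivity, fun y ↦ ?_⟩
  have hq := quad_nonneg hQ y
  have e : ‖y‖ ^ p = (‖y‖ ^ 2) ^ (p / 2) := by
    rw [← Real.rpow_natCast, ← Real.rpow_mul (norm_nonneg y)]
    congr 1
    push_cast
    ring
  rw [e, ← Real.mul_rpow (by positivity) (by positivity)]
  refine Real.rpow_le_rpow (by positivity) ?_ (by positivity)
  rw [inv_mul_eq_div, le_div_iff₀ hc]
  linarith [h y]

section
variable {Ω : Type*} [MeasurableSpace Ω] {μ : Measure Ω} {n d m : ℕ}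

/-! ### Sampling of the driving processes at the grid points, and the recursion for the weighted
moments -/

theorem IsBrownianMotion.map_increment {B : ℝ≥0 → Ω → Vec d} (hB : IsBrownianMotion B μ)
    (δ : ℝ≥0) (k : ℕ) :
    μ.map (fun ω ↦ B ((k + 1 : ℕ) * δ) ω - B (k * δ) ω) =
      (stdGaussian (Vec d)).map fun ζ ↦ √(δ : ℝ) • ζ := by
  have hle : (k : ℝ≥0) * δ ≤ (k + 1 : ℕ) * δ := by
    gcongr
    omega
  rw [(hB.law_increment _ _ hle).map_eq]
  have : (((k + 1 : ℕ) * δ : ℝ≥0) : ℝ) - ((k * δ : ℝ≥0) : ℝ) = δ := by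
    push_cast
    ring
  rw [this]

theorem IsBrownianMotion.iIndepFun_increment {B : ℝ≥0 → Ω → Vec d} (hB : IsBrownianMotion B μ)
    (δ : ℝ≥0) : iIndepFun (fun (k : ℕ) ω ↦ B ((k + 1 : ℕ) * δ) ω - B (k * δ) ω) μ :=
  hB.indepIncrements.nat (t := fun k : ℕ ↦ (k : ℝ≥0) * δ) fun a b hab ↦ by
    simp only
    gcongr

theorem indepFun_skeleton {B : ℝ≥0 → Ω → Vec d} {r : ℝ≥0 → Ω → Fin m}
    (hrB : IndepFun (fun ω t ↦ r t ω) (fun ω t ↦ B t ω) μ) (δ : ℝ≥0) :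
    IndepFun (fun ω (k : ℕ) ↦ r (k * δ) ω)
      (fun ω (k : ℕ) ↦ B ((k + 1 : ℕ) * δ) ω - B (k * δ) ω) μ := by
  have h1 : Measurable fun (x : ℝ≥0 → Fin m) (k : ℕ) ↦ x (k * δ) :=
    measurable_pi_lambda _ fun k ↦ measurable_pi_apply _
  have h2 : Measurable fun (x : ℝ≥0 → Vec d) (k : ℕ) ↦ x ((k + 1 : ℕ) * δ) - x (k * δ) :=
    measurable_pi_lambda _ fun k ↦ (measurable_pi_apply _).sub (measurable_pi_apply _)
  exact hrB.comp h1 h2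

theorem exists_moment_bound [IsProbabilityMeasure μ]
    {B : ℝ≥0 → Ω → Vec d} (hB : IsBrownianMotion B μ)
    {Γ : Matrix (Fin m) (Fin m) ℝ} (hΓ : IsGenerator Γ)
    {r : ℝ≥0 → Ω → Fin m} (hr : IsMarkovChain r Γ μ)
    (hrB : IndepFun (fun ω t ↦ r t ω) (fun ω t ↦ B t ω) μ) {x₀ : Vec n}
    {f : Vec n → Fin m → Vec n} {g : Vec n → Fin m → Matrix (Fin n) (Fin d) ℝ}
    (hfg : LocallyLip f g) {pbar : ℝ} {Q : Matrix (Fin n) (Fin n) ℝ} (hQ : Q.PosDef)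
    {α : Fin m → ℝ} (hgrowth : ∀ i, GrowthCondition f g Q pbar i (α i))
    {φ : Fin m → ℝ → ℝ} (hφ : ∀ i, IsGrowthFunction f g i (φ i)) {θ K : ℝ} (hθ : 0 < θ)
    {h : ℝ → ℝ} (hh : IsStepFunction φ x₀ θ K h) {p : ℝ} (hp₀ : 0 < p) (hp : p ≤ pbar)
    {ξ : Fin m → ℝ} (hξ : ∀ i, 0 < ξ i) (hΓξ : ∀ i, (Γ *ᵥ ξ) i + p / 2 * α i * ξ i = -1) :
    ∃ b : ℝ, 0 ≤ b ∧ ∀ᶠ δ : ℝ≥0 in 𝓝[>] 0, ∀ k : ℕ,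
      ∫⁻ ω, ENNReal.ofReal (ξ (r (k * δ) ω)) *
        ENNReal.ofReal ((1 + quad Q (em f g φ h B r x₀ δ k ω)) ^ (p / 2)) ∂μ
      ≤ ENNReal.ofReal b := by
  obtain ⟨P, hP, hPo⟩ := hr.transition
  set S := ∑ j, ξ j with hS
  have hS0 : 0 ≤ S := Finset.sum_nonneg fun j _ ↦ (hξ j).le
  set η := 1 / (8 * (1 + S)) with hη
  have hη0 : 0 < η := by positivity
  obtain ⟨C, hC, hstep⟩ :=
    eventually_lintegral_truncated_step_le hfg hQ hp₀ hp hgrowth hφ hθ hh hη0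
  set κ := 1 / (2 * (1 + S)) with hκ
  have hκ0 : 0 < κ := by positivity
  have hκ1 : κ ≤ 1 := by
    rw [hκ, div_le_one (by positivity)]
    linarith
  -- `W` bounds the one-step averages of `ξ` for all `δ ≤ 1`; it multiplies the additive error `Cδ`.
  set W := S + ∑ i, |(Γ *ᵥ ξ) i| + 1 with hW
  have hW0 : 0 ≤ W := by positivity
  have hq₀ := quad_nonneg hQ x₀
  -- The second term is the fixed point of `U ↦ (1 - κδ)U + WCδ`, in which `δ` cancels; the first
  -- dominates the initial value.
  set b := S * (1 + quad Q x₀) ^ (p / 2) + W * C / κ with hb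
  have hb0 : 0 ≤ b := by positivity
  refine ⟨b, hb0, ?_⟩
  have hcoe : Tendsto (fun δ : ℝ≥0 ↦ (δ : ℝ)) (𝓝[>] 0) (𝓝[>] 0) := by
    refine tendsto_nhdsWithin_iff.mpr ⟨?_, ?_⟩
    · exact (NNReal.continuous_coe.tendsto' 0 0 NNReal.coe_zero).mono_left nhdsWithin_le_nhds
    · filter_upwards [self_mem_nhdsWithin] with δ hδ
      exact NNReal.coe_pos.mpr hδ
  filter_upwards [hcoe.eventually hstep, eventually_transition_bounds hΓ hPo hξ hη0,
    eventually_contraction (β := fun i ↦ p / 2 * α i) hξ hΓξ hη,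
    Ioc_mem_nhdsGT (zero_lt_one' ℝ≥0)] with δ hδs hδP hδc hδ k
  have hδ0 : 0 < (δ : ℝ) := NNReal.coe_pos.mpr hδ.1
  have hδ1 : (δ : ℝ) ≤ 1 := by exact_mod_cast hδ.2
  have hφh : ∀ i, φ i 1 ≤ h δ := hh.apply_one_le hφ ⟨hδ0, hδ1⟩
  set R : ℕ → Ω → Fin m := fun k ω ↦ r (k * δ) ω with hRdef
  set Z : ℕ → Ω → Vec d := fun k ω ↦ B ((k + 1 : ℕ) * δ) ω - B (k * δ) ω with hZdef
  have hR : ∀ k, Measurable (R k) := fun k ↦ hr.measurable _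
  have hZ : ∀ k, Measurable (Z k) := fun k ↦ (hB.measurable _).sub (hB.measurable _)
  set U : ℕ → ENNReal := fun k ↦ ∫⁻ ω, ENNReal.ofReal (ξ (R k ω)) *
    pathMoment f g φ h x₀ δ Q (p / 2) μ Z (fun l ↦ R l ω) k ∂μ with hU
  have hUeq : ∀ k : ℕ, ∫⁻ ω, ENNReal.ofReal (ξ (r (k * δ) ω)) *
        ENNReal.ofReal ((1 + quad Q (em f g φ h B r x₀ δ k ω)) ^ (p / 2)) ∂μ = U k := by
    intro k
    simp_rw [em_eq_pathEM]
    exact lintegral_weighted_eq hfg hZ hR (indepFun_skeleton hrB δ) ξ k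
  rw [hUeq]
  have hκδ : 0 ≤ 1 - κ * δ := by nlinarith
  refine le_of_affine_recursion (κ := 1 - κ * δ) (D := W * (C * δ)) hκδ (by positivity) hb0
    ?_ ?_ (fun k ↦ ?_) k
  · have h1 : W * C ≤ κ * b := by
      have h2 : κ * b = κ * (S * (1 + quad Q x₀) ^ (p / 2)) + W * C := by
        rw [hb]
        field_simp
      rw [h2]
      have : 0 ≤ κ * (S * (1 + quad Q x₀) ^ (p / 2)) := by positivity
      linarith
    nlinarith
  · have h0 : ∀ ω, ENNReal.ofReal (ξ (r ((0 : ℕ) * δ) ω)) *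
        ENNReal.ofReal ((1 + quad Q (em f g φ h B r x₀ δ 0 ω)) ^ (p / 2)) ≤
        ENNReal.ofReal b := by
      intro ω
      rw [← ENNReal.ofReal_mul (hξ _).le]
      refine ENNReal.ofReal_le_ofReal ?_
      have h1 : quad Q (em f g φ h B r x₀ δ 0 ω) ≤ quad Q x₀ :=
        quad_truncate_le hQ (hφ _) (hφh _) x₀
      have h2 := quad_nonneg hQ (em f g φ h B r x₀ δ 0 ω)
      have h3 : ξ (r ((0 : ℕ) * δ) ω) ≤ S :=
        Finset.single_le_sum (fun j _ ↦ (hξ j).le) (Finset.mem_univ _)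
      have h4 : 0 ≤ W * C / κ := by positivity
      calc ξ (r ((0 : ℕ) * δ) ω) * (1 + quad Q (em f g φ h B r x₀ δ 0 ω)) ^ (p / 2)
          ≤ S * (1 + quad Q x₀) ^ (p / 2) := by gcongr
        _ ≤ b := by rw [hb]; linarith
    rw [← hUeq]
    exact (lintegral_mono h0).trans (by simp)
  · rw [ENNReal.ofReal_mul hW0]
    refine lintegral_weighted_succ_le (P := P δ) (A := fun i ↦ 1 + δ * (p / 2 * α i + η)) hR
      (fun ρ ↦ pathMoment_succ_le hfg hQ (by positivity) hφ hφh hZ (hB.iIndepFun_increment δ)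
        (fun k ↦ hB.map_increment δ k) hδs ρ k)
      (fun ρ j ↦ (measure_markov_eq hP δ k ρ j).le) (fun i ↦ ?_) (fun i ↦ ?_)
    · obtain ⟨h1, h2⟩ := hδP i
      rw [← ENNReal.ofReal_mul hκδ]
      calc _ ≤ ENNReal.ofReal (ξ i + δ * ((Γ *ᵥ ξ) i + η * S)) *
            ENNReal.ofReal (1 + δ * (p / 2 * α i + η)) := by gcongr
        _ ≤ _ := by
            rw [← ENNReal.ofReal_mul h1]
            exact ENNReal.ofReal_le_ofReal (hδc i)
    · refine (hδP i).2.trans (ENNReal.ofReal_le_ofReal ?_)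
      have h1 : ξ i ≤ S := Finset.single_le_sum (fun j _ ↦ (hξ j).le) (Finset.mem_univ i)
      have h2 : |(Γ *ᵥ ξ) i| ≤ ∑ i, |(Γ *ᵥ ξ) i| :=
        Finset.single_le_sum (f := fun i ↦ |(Γ *ᵥ ξ) i|) (fun _ _ ↦ abs_nonneg _)
          (Finset.mem_univ i)
      have h3 : η * S ≤ 1 := by
        rw [hη, one_div, inv_mul_le_iff₀ (by positivity)]
        linarith
      have h4 := le_abs_self ((Γ *ᵥ ξ) i)
      have h5 : (δ : ℝ) * ((Γ *ᵥ ξ) i + η * S) ≤ 1 * (|(Γ *ᵥ ξ) i| + 1) := by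
        have : (Γ *ᵥ ξ) i + η * S ≤ |(Γ *ᵥ ξ) i| + 1 := by linarith
        calc _ ≤ (δ : ℝ) * (|(Γ *ᵥ ξ) i| + 1) := by gcongr
          _ ≤ _ := by gcongr
      linarith

end

end TruncatedEM

/-! ### From the weighted moments to the moments of the iterates -/

theorem theorem4p3 {Ω : Type*} [MeasurableSpace Ω] (μ : Measure Ω) [IsProbabilityMeasure μ]
    {n d m : ℕ}
    -- the driving Brownian motion and the independent Markov chain started from `ℓ`
    (B : ℝ≥0 → Ω → TruncatedEM.Vec d) (hB : TruncatedEM.IsBrownianMotion B μ)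
    (Γ : Matrix (Fin m) (Fin m) ℝ) (hΓ : TruncatedEM.IsGenerator Γ)
    (ϖ : Fin m → ℝ) (hϖ : TruncatedEM.IsIrreducibleWith Γ ϖ)
    (r : ℝ≥0 → Ω → Fin m) (hr : TruncatedEM.IsMarkovChain r Γ μ)
    (hrB : IndepFun (fun ω t ↦ r t ω) (fun ω t ↦ B t ω) μ)
    (x₀ : TruncatedEM.Vec n) (ℓ : Fin m) (hℓ : ∀ᵐ ω ∂μ, r 0 ω = ℓ)
    -- the coefficients
    (f : TruncatedEM.Vec n → Fin m → TruncatedEM.Vec n)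
    (g : TruncatedEM.Vec n → Fin m → Matrix (Fin n) (Fin d) ℝ)
    (hfg : TruncatedEM.LocallyLip f g)
    (pbar : ℝ) (hpbar : 0 < pbar)
    (Q : Matrix (Fin n) (Fin n) ℝ) (hQ : Q.PosDef) (α : Fin m → ℝ)
    (hgrowth : ∀ i, TruncatedEM.GrowthCondition f g Q pbar i (α i))
    (hα : ∑ i, ϖ i * α i < 0)
    -- the truncation
    (φ : Fin m → ℝ → ℝ) (hφ : ∀ i, TruncatedEM.IsGrowthFunction f g i (φ i))
    (θ : ℝ) (hθ₀ : 0 < θ) (hθ₁ : θ < 1 / 2) (K : ℝ)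
    (h : ℝ → ℝ) (hh : TruncatedEM.IsStepFunction φ x₀ θ K h)
    -- the exponent
    (p : ℝ) (hp₀ : 0 < p) (hpstar : (p : EReal) < TruncatedEM.pStar Γ α) (hp : p ≤ pbar) :
    ∃ Δstar : ℝ≥0, 0 < Δstar ∧ Δstar ≤ 1 ∧ ∃ C : ℝ, ∀ Δ : ℝ≥0, 0 < Δ → Δ ≤ Δstar → ∀ k : ℕ,
      Integrable (fun ω ↦ ‖TruncatedEM.em f g φ h B r x₀ Δ k ω‖ ^ p) μ ∧
      ∫ ω, ‖TruncatedEM.em f g φ h B r x₀ Δ k ω‖ ^ p ∂μ ≤ C := by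
  obtain ⟨ξ, hξ, hΓξ⟩ := TruncatedEM.exists_pos_vector hΓ hϖ hα hp₀ hpstar
  obtain ⟨b, hb, hev⟩ := TruncatedEM.exists_moment_bound hB hΓ hr hrB hfg hQ hgrowth hφ hθ₀ hh
    hp₀ hp hξ hΓξ
  obtain ⟨c, hc, hnorm⟩ := TruncatedEM.exists_norm_rpow_le hQ hp₀
  obtain ⟨u, hu, hsub⟩ := mem_nhdsGT_iff_exists_Ioc_subset.mp hev
  -- Since `1 ≤ T ξ_i` for every state, the factor `T` removes the weights.
  set T := ∑ i, (ξ i)⁻¹ with hT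
  have hT0 : 0 ≤ T := Finset.sum_nonneg fun i _ ↦ (inv_pos.mpr (hξ i)).le
  refine ⟨min u 1, lt_min hu one_pos, min_le_right _ _, c * T * b, fun Δ hΔ hΔu k ↦ ?_⟩
  have hbound := hsub ⟨hΔ, hΔu.trans (min_le_left _ _)⟩ k
  have hR : ∀ l : ℕ, Measurable (r (l * Δ)) := fun l ↦ hr.measurable _
  have hZ : ∀ l : ℕ, Measurable fun ω ↦ B ((l + 1 : ℕ) * Δ) ω - B (l * Δ) ω :=
    fun l ↦ (hB.measurable _).sub (hB.measurable _)
  have hem : Measurable (TruncatedEM.em f g φ h B r x₀ Δ k) := by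
    have h1 := (TruncatedEM.measurable_pathEM φ h x₀ Δ hfg k).comp
      ((measurable_pi_lambda _ hR).prodMk (measurable_pi_lambda _ hZ))
    convert h1 using 1
    funext ω
    exact TruncatedEM.em_eq_pathEM f g φ h x₀ B r Δ k ω
  refine TruncatedEM.integrable_and_integral_le_of_lintegral_le (hem.norm.pow_const p)
    (fun ω ↦ by positivity) (by positivity) ?_
  calc ∫⁻ ω, ENNReal.ofReal (‖TruncatedEM.em f g φ h B r x₀ Δ k ω‖ ^ p) ∂μ
      ≤ ∫⁻ ω, ENNReal.ofReal (c * T) * (ENNReal.ofReal (ξ (r (k * Δ) ω)) * ENNReal.ofReal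
          ((1 + TruncatedEM.quad Q (TruncatedEM.em f g φ h B r x₀ Δ k ω)) ^ (p / 2))) ∂μ := by
        refine lintegral_mono fun ω ↦ ?_
        simp only
        rw [← ENNReal.ofReal_mul (hξ _).le, ← ENNReal.ofReal_mul (by positivity)]
        refine ENNReal.ofReal_le_ofReal ((hnorm _).trans ?_)
        have hq := TruncatedEM.quad_nonneg hQ (TruncatedEM.em f g φ h B r x₀ Δ k ω)
        have h1 : 1 ≤ T * ξ (r (k * Δ) ω) := by
          have h2 : (ξ (r (k * Δ) ω))⁻¹ ≤ T := Finset.single_le_sum (f := fun i ↦ (ξ i)⁻¹)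
            (fun i _ ↦ (inv_pos.mpr (hξ i)).le) (Finset.mem_univ _)
          exact (inv_le_iff_one_le_mul₀ (hξ _)).mp h2
        set V := (1 + TruncatedEM.quad Q (TruncatedEM.em f g φ h B r x₀ Δ k ω)) ^ (p / 2)
        have hV : 0 ≤ V := by positivity
        calc c * V ≤ c * V * (T * ξ (r (k * Δ) ω)) :=
              le_mul_of_one_le_right (by positivity) h1
          _ = _ := by ring
    _ ≤ ENNReal.ofReal (c * T) * ENNReal.ofReal b := by
        rw [lintegral_const_mul' _ _ ENNReal.ofReal_ne_top]
        gcongr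
    _ = ENNReal.ofReal (c * T * b) := (ENNReal.ofReal_mul (by positivity)).symm
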